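/- Let $G$ be a group and $k$ a commutative ring. Let $\mathrm{FI}_G$ be the category whose objects are the sets $[n]=\{1,\dots,n\}$, $n\ge 0$, and whose morphisms $[m]\to[n]$ are pairs $(f,g)$ of an injection $f:[m]\to[n]$ and a map $g:[m]\to G$, with $(f,g)\circ(f',g')=(f\circ f',\,x\mapsto g'(x)\,g(f'(x)))$; let $\mathrm{FB}_G$ be its subcategory with the same objects and the morphisms with $f$ bijective, and $G_n=\mathrm{Aut}_{\mathrm{FI}_G}([n])$. An $\mathrm{FI}_G$-module (resp. $\mathrm{FB}_G$-module) is a functor from $\mathrm{FI}_G$ (resp. $\mathrm{FB}_G$) to $k$-modules; write $V_n=V([n])$. The free module $M(n)$ is $M(n)_m=k[\mathrm{Hom}_{\mathrm{FI}_G}([n],[m])]$. For an $\mathrm{FB}_G$-module $W$ put $M(W)=\bigoplus_{n\ge0}M(W_n)$ with $M(W_n)_m=W_n\otimes_{k[G_n]}k[\mathrm{Hom}_{\mathrm{FI}_G}([n],[m])]$; modules isomorphic to some $M(W)$ are called relatively projective. $V$ is generated in degree $\le m$ if there is a surjection $\bigoplus_{i\in I}M(n_i)\twoheadrightarrow V$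 with all $n_i\le m$, and generated in finite degree if this holds for some $m$. $V$ is presented in finite degree if it is generated in finite degree and there is an exact sequence $0\to K\to M\to V\to0$ with $M$ relatively projective and $K$ generated in finite degree. $H_0$ is the functor from $\mathrm{FI}_G$-modules to $\mathrm{FB}_G$-modules with $H_0(V)_n=V_n/V_{<n}$, where $V_{<n}$ is spanned by the images of all maps $V_m\to V_n$ induced by morphisms $[m]\to[n]$ with $m<n$; $H_i$ is the $i$-th left derived functor of $H_0$; and $V$ is homology acyclic if $H_i(V)=0$ for all $i\ge1$. **Theorem.** Let $V$ be an $\mathrm{FI}_G$-module over $k$ which is generated in finite degree. Then the following are equivalent: 1. $V$ is $\sharp$-filtered: it admits a filtration $0=V^{(0)}\subseteq V^{(1)}\subseteq\dots\subseteq V^{(n)}=V$ whose cofactors $V^{(i)}/V^{(i-1)}$ are relatively projective; 2. there is a series of surjections $V=Q^{(n)}\twoheadrightarrow Q^{(n-1)}\twoheadrightarrow\dots\twoheadrightarrow Q^{(0)}=0$ whose successive kernels are relatively projective; 3. $V$ is homology acyclic; 4. $H_1(V)=0$; 5. $V$ admits a finite resolution $0\to X_N\to\dots\to X_0\to V\to0$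 by homology acyclic modules which are generated in finite degree. If, in addition, $V$ is presented in finite degree, then the condition that $H_i(V)=0$ for some $i>0$ is also equivalent to the above. -/

import Mathlib

open CategoryTheory CategoryTheory.Limits
open scoped TensorProduct

universe u

namespace FIG

noncomputable section

/-! ### The categories `FI_G` and `FB_G` -/

/-- The category `FI_G` (in its skeletal form): the objects are the sets `[n] = Fin n`. -/
structure FI (G : Type u) : Type where
  /-- the cardinality `n` of the object `[n]` -/
  card : ℕ

/-- A morphism `[m] ⟶ [n]` of `FI_G`: an injection `f` together with a map of sets into `G`. -/
@[ext]
structure FIHom (G : Type u) (m n : ℕ) : Type u where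
  /-- the underlying injection -/
  f : Fin m ↪ Fin n
  /-- the decoration by elements of `G` -/
  g : Fin m → G

instance instCategoryFI (G : Type u) [Group G] : Category.{u} (FI G) where
  Hom X Y := FIHom G X.card Y.card
  id X := ⟨Function.Embedding.refl _, fun _ => 1⟩
  comp φ ψ := ⟨φ.f.trans ψ.f, fun x => φ.g x * ψ.g (φ.f x)⟩
  id_comp φ := by
    apply FIHom.ext
    · rfl
    · funext x; exact one_mul _
  comp_id φ := by
    apply FIHom.ext
    · rfl
    · funext x; exact mul_one _
  assoc φ ψ χ := by
    apply FIHom.ext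
    · rfl
    · funext x; exact mul_assoc _ _ _

/-- The subcategory `FB_G` of `FI_G`: the objects are the sets `[n]`, the morphisms are the
pairs `(f, g)` with `f` bijective. -/
structure FB (G : Type u) : Type where
  /-- the cardinality `n` of the object `[n]` -/
  card : ℕ

instance instCategoryFB (G : Type u) [Group G] : Category.{u} (FB G) where
  Hom X Y := {φ : (FI.mk X.card : FI G) ⟶ FI.mk Y.card // Function.Bijective φ.f}
  id _ := ⟨𝟙 _, Function.bijective_id⟩
  comp φ ψ := ⟨φ.1 ≫ ψ.1, ψ.2.comp φ.2⟩
  id_comp φ := Subtype.ext (Category.id_comp φ.1)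
  comp_id φ := Subtype.ext (Category.comp_id φ.1)
  assoc φ ψ χ := Subtype.ext (Category.assoc φ.1 ψ.1 χ.1)

/-- `FI_G`-modules over `k`. -/
abbrev FIModule (G : Type u) [Group G] (k : Type u) [CommRing k] := FI G ⥤ ModuleCat.{u} k

/-- `FB_G`-modules over `k`. -/
abbrev FBModule (G : Type u) [Group G] (k : Type u) [CommRing k] := FB G ⥤ ModuleCat.{u} k

variable {G : Type u} [Group G] {k : Type u} [CommRing k]

/-! ### Free and relatively projective modules -/

/-- The free `FI_G`-module `M(n)`, with `M(n)_m = k[Hom([n], [m])]`. -/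
def free (G : Type u) [Group G] (k : Type u) [CommRing k] (n : ℕ) : FIModule G k :=
  coyoneda.obj (Opposite.op (FI.mk n : FI G)) ⋙ ModuleCat.free k

/-- The relations of the tensor product over the group ring of `G_n = Aut([n])`: the submodule of
`W_n ⊗_k k[Hom([n], [m])]` spanned by the elements `σ w ⊗ φ - w ⊗ (φ ∘ σ)`. -/
def balancedRel (W : FBModule G k) (n : ℕ) (Y : FI G) :
    Submodule k (W.obj (FB.mk n) ⊗[k] (((FI.mk n : FI G) ⟶ Y) →₀ k)) :=
  Submodule.span k {t | ∃ (σ : (FB.mk n : FB G) ⟶ FB.mk n) (φ : (FI.mk n : FI G) ⟶ Y)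
    (w : W.obj (FB.mk n)),
    t = ((W.map σ).hom w) ⊗ₜ[k] Finsupp.single φ 1 - w ⊗ₜ[k] Finsupp.single (σ.1 ≫ φ) 1}

/-- The map `W_n ⊗_k k[Hom([n], Y)] → W_n ⊗_k k[Hom([n], Z)]` given by composition with
`ψ : Y ⟶ Z` in the second factor. -/
def postcomp (W : FBModule G k) (n : ℕ) {Y Z : FI G} (ψ : Y ⟶ Z) :
    W.obj (FB.mk n) ⊗[k] (((FI.mk n : FI G) ⟶ Y) →₀ k) →ₗ[k]
      W.obj (FB.mk n) ⊗[k] (((FI.mk n : FI G) ⟶ Z) →₀ k) :=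
  LinearMap.lTensor _ (Finsupp.lmapDomain k k (fun φ => φ ≫ ψ))

lemma postcomp_tmul_single (W : FBModule G k) (n : ℕ) {Y Z : FI G} (ψ : Y ⟶ Z)
    (w : W.obj (FB.mk n)) (φ : (FI.mk n : FI G) ⟶ Y) :
    postcomp W n ψ (w ⊗ₜ[k] Finsupp.single φ 1) = w ⊗ₜ[k] Finsupp.single (φ ≫ ψ) 1 := by
  simp [postcomp, Finsupp.lmapDomain_apply, Finsupp.mapDomain_single]

lemma balancedRel_le (W : FBModule G k) (n : ℕ) {Y Z : FI G} (ψ : Y ⟶ Z) :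
    balancedRel W n Y ≤ (balancedRel W n Z).comap (postcomp W n ψ) := by
  refine Submodule.span_le.2 ?_
  rintro _ ⟨σ, φ, w, rfl⟩
  refine Submodule.subset_span ⟨σ, φ ≫ ψ, w, ?_⟩
  rw [map_sub, postcomp_tmul_single, postcomp_tmul_single, Category.assoc]

/-- The `FI_G`-module `M(W_n)`, with `M(W_n)_m = W_n ⊗_{k[G_n]} k[Hom([n], [m])]`, where `W_n` is
the degree `n` part of the `FB_G`-module `W`. -/
def relProjPiece (W : FBModule G k) (n : ℕ) : FIModule G k where
  obj Y := ModuleCat.of k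
    ((W.obj (FB.mk n) ⊗[k] (((FI.mk n : FI G) ⟶ Y) →₀ k)) ⧸ balancedRel W n Y)
  map ψ := ModuleCat.ofHom (Submodule.mapQ _ _ (postcomp W n ψ) (balancedRel_le W n ψ))
  map_id Y := by
    ext : 1
    have h : postcomp W n (𝟙 Y) = LinearMap.id := by
      have : (fun φ : (FI.mk n : FI G) ⟶ Y => φ ≫ 𝟙 Y) = id := by
        funext φ; exact Category.comp_id φ
      rw [postcomp, this, Finsupp.lmapDomain_id, LinearMap.lTensor_id]
    simp only [h, Submodule.mapQ_id]
    rfl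
  map_comp {X Y Z} ψ χ := by
    ext : 1
    have h : postcomp W n (ψ ≫ χ) = postcomp W n χ ∘ₗ postcomp W n ψ := by
      have : (fun φ : (FI.mk n : FI G) ⟶ X => φ ≫ ψ ≫ χ) =
          (fun φ => φ ≫ χ) ∘ (fun φ => φ ≫ ψ) := by
        funext φ; exact (Category.assoc φ ψ χ).symm
      rw [postcomp, this, Finsupp.lmapDomain_comp, LinearMap.lTensor_comp]
      rfl
    simp only [h, Submodule.mapQ_comp _ (balancedRel W n Y) _ _ _
      (balancedRel_le W n ψ) (balancedRel_le W n χ)]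
    rfl

/-- The `FI_G`-module `M(W) = ⨁ₙ M(W_n)` of an `FB_G`-module `W`. -/
def relProj (W : FBModule G k) : FIModule G k := ∐ fun n : ℕ => relProjPiece W n

/-- `V` is relatively projective: it is (isomorphic to) `M(W)` for some `FB_G`-module `W`. -/
def IsRelProjective (V : FIModule G k) : Prop :=
  ∃ W : FBModule G k, Nonempty (V ≅ relProj W)

/-! ### Generation and presentation in finite degree -/

/-- `V` is generated in degree `≤ m`: there is a surjection onto `V` from a direct sum of free
modules `M(nᵢ)` with all `nᵢ ≤ m`. -/
def GeneratedInDegreeLE (V : FIModule G k) (m : ℕ) : Prop :=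
  ∃ (I : Type u) (d : I → ℕ) (p : (∐ fun i => free G k (d i)) ⟶ V), (∀ i, d i ≤ m) ∧ Epi p

/-- `V` is generated in finite degree. -/
def GeneratedInFiniteDegree (V : FIModule G k) : Prop :=
  ∃ m : ℕ, GeneratedInDegreeLE V m

/-- `V` has relation degree `≤ r`: there is an exact sequence `0 → K → M → V → 0` with `M`
relatively projective and `K` generated in degree `≤ r`. -/
def RelationDegreeLE (V : FIModule G k) (r : ℕ) : Prop :=
  ∃ (K M : FIModule G k) (i : K ⟶ M) (p : M ⟶ V) (w : i ≫ p = 0),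
    (ShortComplex.mk i p w).ShortExact ∧ IsRelProjective M ∧ GeneratedInDegreeLE K r

/-- `V` is presented in finite degree: its generating and relation degrees are finite. -/
def PresentedInFiniteDegree (V : FIModule G k) : Prop :=
  GeneratedInFiniteDegree V ∧ ∃ r : ℕ, RelationDegreeLE V r

/-! ### Homology -/

/-- The submodule `V_{<n}` of `V_n` spanned by the images of all transition maps into `V_n`. -/
def lower (V : FIModule G k) (n : ℕ) : Submodule k (V.obj (FI.mk n)) :=
  ⨆ (m : ℕ) (_ : m < n) (φ : (FI.mk m : FI G) ⟶ FI.mk n), LinearMap.range (V.map φ).hom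

lemma mem_lower (V : FIModule G k) {m n : ℕ} (h : m < n) (φ : (FI.mk m : FI G) ⟶ FI.mk n)
    (x : V.obj (FI.mk m)) : (V.map φ).hom x ∈ lower V n :=
  (le_iSup_of_le m (le_iSup_of_le h (le_iSup_of_le φ le_rfl)) :
    LinearMap.range (V.map φ).hom ≤ lower V n) ⟨x, rfl⟩

lemma lower_le (V : FIModule G k) (n : ℕ) (P : Submodule k (V.obj (FI.mk n)))
    (h : ∀ (m : ℕ) (_ : m < n) (φ : (FI.mk m : FI G) ⟶ FI.mk n) (x : V.obj (FI.mk m)),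
      (V.map φ).hom x ∈ P) : lower V n ≤ P := by
  refine iSup_le fun m => iSup_le fun hm => iSup_le fun φ => ?_
  rintro _ ⟨x, rfl⟩
  exact h m hm φ x

lemma lower_le_comap_map (V : FIModule G k) {X Y : FB G} (σ : X ⟶ Y) :
    lower V X.card ≤ (lower V Y.card).comap (V.map σ.1).hom := by
  refine lower_le V _ _ fun m hm φ x => ?_
  have hXY : X.card ≤ Y.card := by simpa using Fintype.card_le_of_embedding σ.1.f
  have h := mem_lower V (lt_of_lt_of_le hm hXY) (φ ≫ σ.1) x
  rw [V.map_comp] at h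
  exact h

lemma lower_le_comap_app {V V' : FIModule G k} (α : V ⟶ V') (n : ℕ) :
    lower V n ≤ (lower V' n).comap (α.app (FI.mk n)).hom := by
  refine lower_le V _ _ fun m hm φ x => ?_
  have h := mem_lower V' hm φ ((α.app (FI.mk m)).hom x)
  have e := ConcreteCategory.congr_hom (α.naturality φ) x
  exact (e ▸ h : _)

/-- The `FB_G`-module `H_0(V)`, with `H_0(V)_n = V_n / V_{<n}`. -/
def zerothHomologyObj (V : FIModule G k) : FBModule G k where
  obj X := ModuleCat.of k (V.obj (FI.mk X.card) ⧸ lower V X.card)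
  map σ := ModuleCat.ofHom (Submodule.mapQ _ _ (V.map σ.1).hom (lower_le_comap_map V σ))
  map_id X := by
    ext x
    have h : (V.map (𝟙 (FI.mk X.card : FI G))).hom x = x := by rw [V.map_id]; rfl
    exact congrArg (Submodule.Quotient.mk (p := lower V X.card)) h
  map_comp {X Y Z} σ τ := by
    ext x
    have h : (V.map (σ.1 ≫ τ.1)).hom x = (V.map τ.1).hom ((V.map σ.1).hom x) := by
      rw [V.map_comp]; rfl
    exact congrArg (Submodule.Quotient.mk (p := lower V Z.card)) h

/-- The functor `H_0` from `FI_G`-modules to `FB_G`-modules. -/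
def zerothHomology (G : Type u) [Group G] (k : Type u) [CommRing k] :
    FIModule G k ⥤ FBModule G k where
  obj V := zerothHomologyObj V
  map {V V'} α :=
    { app := fun X => ModuleCat.ofHom
        (Submodule.mapQ _ _ (α.app (FI.mk X.card)).hom (lower_le_comap_app α X.card))
      naturality := fun X Y σ => by
        ext x
        obtain ⟨y, rfl⟩ := Submodule.Quotient.mk_surjective _ x
        exact congrArg (Submodule.Quotient.mk (p := lower V' Y.card))
          (ConcreteCategory.congr_hom (α.naturality σ.1) y) }
  map_id V := by
    ext X x
    obtain ⟨y, rfl⟩ := Submodule.Quotient.mk_surjective _ x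
    rfl
  map_comp α β := by
    ext X x
    obtain ⟨y, rfl⟩ := Submodule.Quotient.mk_surjective _ x
    rfl

instance instAdditiveZerothHomology : (zerothHomology G k).Additive where
  map_add {V V' α β} := by
    ext X x
    obtain ⟨y, rfl⟩ := Submodule.Quotient.mk_surjective _ x
    rfl

/-! The category of `FI_G`-modules has enough projectives. -/

lemma exists_free_hom (V : FIModule G k) (n : ℕ) (x : V.obj (FI.mk n)) :
    ∃ ψ : free G k n ⟶ V,
      (ψ.app (FI.mk n)).hom (ModuleCat.freeMk (𝟙 (FI.mk n : FI G))) = x := by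
  refine ⟨{ app := fun Y => ModuleCat.freeDesc
              (TypeCat.ofHom fun f : (FI.mk n : FI G) ⟶ Y => (V.map f).hom x)
            naturality := fun Y Z g => ?_ }, ?_⟩
  · refine ModuleCat.free_hom_ext fun f => ?_
    have h1 : ((ModuleCat.free k).map ((coyoneda.obj (Opposite.op (FI.mk n : FI G))).map g)).hom
        (ModuleCat.freeMk f) = ModuleCat.freeMk (f ≫ g) := ModuleCat.free_map_apply _ _
    have h2 : (V.map (f ≫ g)).hom x = (V.map g).hom ((V.map f).hom x) := by
      rw [V.map_comp]; rfl
    refine (congrArg (ModuleCat.freeDesc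
      (TypeCat.ofHom fun f : (FI.mk n : FI G) ⟶ Z => (V.map f).hom x)).hom h1).trans ?_
    refine (ModuleCat.freeDesc_apply _ (f ≫ g)).trans (h2.trans ?_)
    exact (congrArg (V.map g).hom (ModuleCat.freeDesc_apply
      (TypeCat.ofHom fun f : (FI.mk n : FI G) ⟶ Y => (V.map f).hom x) f)).symm
  · refine (ModuleCat.freeDesc_apply _ (𝟙 (FI.mk n : FI G))).trans ?_
    change (V.map (𝟙 (FI.mk n : FI G))).hom x = x
    rw [V.map_id]; rfl

lemma free_hom_ext {V : FIModule G k} {n : ℕ} {φ ψ : free G k n ⟶ V}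
    (h : (φ.app (FI.mk n)).hom (ModuleCat.freeMk (𝟙 (FI.mk n : FI G))) =
      (ψ.app (FI.mk n)).hom (ModuleCat.freeMk (𝟙 (FI.mk n : FI G)))) : φ = ψ := by
  ext Y : 2
  refine ModuleCat.free_hom_ext fun f => ?_
  have h1 : ((free G k n).map f).hom (ModuleCat.freeMk (𝟙 (FI.mk n : FI G))) =
      ModuleCat.freeMk f :=
    (ModuleCat.free_map_apply _ _).trans (congrArg ModuleCat.freeMk (Category.id_comp f))
  have key : ∀ χ : free G k n ⟶ V, (χ.app Y).hom (ModuleCat.freeMk f) =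
      (V.map f).hom ((χ.app (FI.mk n)).hom (ModuleCat.freeMk (𝟙 (FI.mk n : FI G)))) := by
    intro χ
    exact (congrArg (χ.app Y).hom h1.symm).trans
      (ConcreteCategory.congr_hom (χ.naturality f) (ModuleCat.freeMk (𝟙 (FI.mk n : FI G))))
  exact (key φ).trans ((congrArg (V.map f).hom h).trans (key ψ).symm)

instance instProjectiveFree (n : ℕ) : Projective (free G k n) where
  factors {E X} φ e he := by
    have hsurj : Function.Surjective (e.app (FI.mk n)).hom :=
      (ModuleCat.epi_iff_surjective _).1 inferInstance
    obtain ⟨x, hx⟩ := hsurj ((φ.app (FI.mk n)).hom (ModuleCat.freeMk (𝟙 (FI.mk n : FI G))))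
    obtain ⟨ψ, hψ⟩ := exists_free_hom E n x
    exact ⟨ψ, free_hom_ext ((congrArg (e.app (FI.mk n)).hom hψ).trans hx)⟩

instance instEnoughProjectives : EnoughProjectives (FIModule G k) where
  presentation V := by
    choose ψ hψ using fun n x => exists_free_hom V n x
    let p : (∐ fun i : (Σ n : ℕ, V.obj (FI.mk n)) => free G k i.1) ⟶ V :=
      Sigma.desc fun i => ψ i.1 i.2
    have hp : Epi p := by
      have : ∀ Y, Epi (p.app Y) := by
        rintro ⟨n⟩
        refine (ModuleCat.epi_iff_surjective _).2 fun x => ?_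
        have h := Sigma.ι_desc (fun i : (Σ n : ℕ, V.obj (FI.mk n)) => ψ i.1 i.2) ⟨n, x⟩
        have h' := congrArg (fun χ : free G k n ⟶ V =>
          (χ.app (FI.mk n)).hom (ModuleCat.freeMk (𝟙 (FI.mk n : FI G)))) h
        exact ⟨_, h'.trans (hψ n x)⟩
      exact NatTrans.epi_of_epi_app p
    exact ⟨{ p := _, f := p, epi := hp }⟩

/-- The homology functors `H_i`: the left derived functors of `H_0`. -/
def homology (G : Type u) [Group G] (k : Type u) [CommRing k] (i : ℕ) :
    FIModule G k ⥤ FBModule G k :=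
  (zerothHomology G k).leftDerived i

/-- `V` is homology acyclic: `H_i(V) = 0` for all `i ≥ 1`. -/
def IsHomologyAcyclic (V : FIModule G k) : Prop :=
  ∀ i : ℕ, 1 ≤ i → IsZero ((homology G k i).obj V)

/-! ### Filtrations, cofiltrations and resolutions -/

/-- `V` is `♯`-filtered: it has a filtration `0 = F 0 ⊆ F 1 ⊆ ⋯ ⊆ F n = V` by submodules with
relatively projective cofactors `F (i + 1) / F i`. -/
def IsSharpFiltered (V : FIModule G k) : Prop :=
  ∃ (n : ℕ) (F : Fin (n + 1) → Subobject V) (h : ∀ i : Fin n, F i.castSucc ≤ F i.succ),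
    F 0 = ⊥ ∧ F (Fin.last n) = ⊤ ∧
      ∀ i : Fin n, IsRelProjective (cokernel ((F i.castSucc).ofLE (F i.succ) (h i)))

/-- `V` has a cofiltration with relatively projective kernels: surjections
`V = Q n ↠ Q (n - 1) ↠ ⋯ ↠ Q 0 = 0` whose kernels are relatively projective. -/
def HasRelProjCofiltration (V : FIModule G k) : Prop :=
  ∃ (n : ℕ) (Q : Fin (n + 1) → FIModule G k) (p : ∀ i : Fin n, Q i.succ ⟶ Q i.castSucc),
    Nonempty (Q (Fin.last n) ≅ V) ∧ IsZero (Q 0) ∧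
      ∀ i : Fin n, Epi (p i) ∧ IsRelProjective (kernel (p i))

/-- `V` has a finite resolution `0 → X_N → ⋯ → X_0 → V → 0` by homology acyclic modules which are
generated in finite degree. -/
def HasFiniteAcyclicResolution (V : FIModule G k) : Prop :=
  ∃ (X : ChainComplex (FIModule G k) ℕ) (π : X ⟶ (ChainComplex.single₀ (FIModule G k)).obj V),
    QuasiIso π ∧ (∃ N : ℕ, ∀ i, N < i → IsZero (X.X i)) ∧
      ∀ i, IsHomologyAcyclic (X.X i) ∧ GeneratedInFiniteDegree (X.X i)

end

end FIG

/-!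
A module `V` over `FI_G` has a natural map to its shift `ΣV`, `(ΣV)_n = V_{n + 1}`, and a derivative
`DV = coker (V ⟶ ΣV)`. Call `V` *derivative-torsion-free* (`DerivTorsionFree`) if the maps
`D^a V ⟶ Σ D^a V` are injective for all `a`. Every condition of the theorem turns out to be
equivalent to this one.

* Relatively projective modules are derivative-torsion-free, because `V ⟶ ΣV` splits naturally for
  them and a splitting for `V` induces one for `DV` (`SplitsShift.deriv`). In a short exact sequence
  `0 → X → Y → Z → 0` any two derivative-torsion-free modules force the third to be so. The
  interesting case is that of `Z`: the kernel of `Z ⟶ ΣZ` embeds into `DX` as a torsion submodule,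
  hence vanishes, and then `0 → DX → DY → DZ → 0` is exact again
  (`IsExact.derivTorsionFree_right`). This covers filtrations, cofiltrations and finite resolutions.

* The derivative shifts `H_0`: `H_0(DV)_n = H_0(V)_{n + 1}` (`cls_mem_lower_iff`). Hence, if
  `0 → K → P → V → 0` is exact and `V` is derivative-torsion-free, the map `H_0(K)_n → H_0(P)_n` is
  the map of `n`-th derivatives in degree `0` and so injective (`ExactUpTo.mem_lower`). The
  converse, `IsExact.derivTorsionFree_of_mem_lower`, holds if `P` is derivative-torsion-free. In terms of
  a projective resolution, `H_i(V) = 0` is the injectivity of `H_0` on the inclusion of the `i`-th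
  syzygy, so it says that the preceding syzygy is derivative-torsion-free, which
  is equivalent to the same property of `V`. Thus the vanishing of a single `H_i(V)`, `i ≥ 1`,
  is equivalent to derivative-torsion-freeness (`isZero_homology_succ_iff`), for every `V`.

* If `V` is derivative-torsion-free, then so are the submodule generated in degrees `< j` and the
  quotient by it. A derivative-torsion-free module which vanishes below degree `j` and is generated
  in degree `j` is relatively projective (`isRelProjective_of_generated`). So the filtration of `V`
  by generating degree, which is finite if `V` is generated in finite degree, has relatively
  projective cofactors.
-/

namespace FIG

noncomputable section

variable {G : Type u} [Group G] {k : Type u} [CommRing k]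

/-! ### Elementwise language for `FI_G`-modules -/

/-- The linear map `V_m → V_n` induced by a morphism `[m] ⟶ [n]`. -/
def act (V : FIModule G k) {m n : ℕ} (φ : (FI.mk m : FI G) ⟶ FI.mk n) :
    V.obj (FI.mk m) →ₗ[k] V.obj (FI.mk n) := (V.map φ).hom

/-- The degree `n` component of a morphism of `FI_G`-modules, as a linear map. -/
def comp {V U : FIModule G k} (α : V ⟶ U) (n : ℕ) :
    V.obj (FI.mk n) →ₗ[k] U.obj (FI.mk n) := (α.app (FI.mk n)).hom

lemma act_act (V : FIModule G k) {l m n : ℕ} (φ : (FI.mk l : FI G) ⟶ FI.mk m)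
    (ψ : (FI.mk m : FI G) ⟶ FI.mk n) (x : V.obj (FI.mk l)) :
    act V ψ (act V φ x) = act V (φ ≫ ψ) x := by
  simp [act]

lemma act_id (V : FIModule G k) {n : ℕ} (x : V.obj (FI.mk n)) :
    act V (𝟙 (FI.mk n : FI G)) x = x := by
  simp [act]

lemma comp_act {V U : FIModule G k} (α : V ⟶ U) {m n : ℕ} (φ : (FI.mk m : FI G) ⟶ FI.mk n)
    (x : V.obj (FI.mk m)) : comp α n (act V φ x) = act U φ (comp α m x) :=
  ConcreteCategory.congr_hom (α.naturality φ) x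

/-- A morphism of `FI_G`-modules from compatible linear maps. -/
def homMk {V U : FIModule G k} (f : ∀ n, V.obj (FI.mk n) →ₗ[k] U.obj (FI.mk n))
    (hf : ∀ {m n : ℕ} (φ : (FI.mk m : FI G) ⟶ FI.mk n) (x : V.obj (FI.mk m)),
      f n (act V φ x) = act U φ (f m x)) : V ⟶ U where
  app Y := ModuleCat.ofHom (f Y.card)
  naturality X Y φ := by
    ext x
    exact hf (m := X.card) (n := Y.card) φ x

lemma hom_ext' {V U : FIModule G k} {α β : V ⟶ U} (h : ∀ n x, comp α n x = comp β n x) :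
    α = β := by
  ext Y x
  exact h Y.card x

lemma act_mem_lower (V : FIModule G k) {m n : ℕ} (h : m < n)
    (φ : (FI.mk m : FI G) ⟶ FI.mk n) (x : V.obj (FI.mk m)) : act V φ x ∈ lower V n :=
  mem_lower V h φ x

lemma comp_mem_lower {V U : FIModule G k} (α : V ⟶ U) {n : ℕ} {x : V.obj (FI.mk n)}
    (hx : x ∈ lower V n) : comp α n x ∈ lower U n := lower_le_comap_app α n hx

lemma lower_zero (V : FIModule G k) : lower V 0 = ⊥ :=
  le_bot_iff.1 (lower_le V 0 ⊥ fun _ h => absurd h (Nat.not_lt_zero _))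

lemma eq_zero_of_mem_lower {V : FIModule G k} {n : ℕ} (h : ∀ m < n, ∀ x : V.obj (FI.mk m), x = 0)
    {x : V.obj (FI.mk n)} (hx : x ∈ lower V n) : x = 0 :=
  (Submodule.mem_bot k).1 (lower_le V n ⊥ (fun m hm φ y => by
    rw [h m hm y, map_zero]; exact zero_mem _) hx)

/-- Surjective maps are surjective on the submodules `V_{<n}`. -/
lemma exists_lower_of_surjective {V U : FIModule G k} (α : V ⟶ U)
    (h : ∀ n, Function.Surjective (comp α n)) {n : ℕ} {y : U.obj (FI.mk n)}
    (hy : y ∈ lower U n) : ∃ x ∈ lower V n, comp α n x = y := by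
  have : lower U n ≤ (lower V n).map (comp α n) := by
    refine lower_le U n _ fun m hm φ y => ?_
    obtain ⟨x, rfl⟩ := h m y
    exact ⟨act V φ x, act_mem_lower V hm φ x, comp_act α φ x⟩
  exact this hy

/-! ### Submodules and quotients -/

/-- A submodule of an `FI_G`-module: submodules of the `V_n` stable under all transition maps. -/
structure Sub (V : FIModule G k) where
  /-- the degree `n` part -/
  deg : ∀ n, Submodule k (V.obj (FI.mk n))
  /-- stability under the transition maps -/
  act_mem : ∀ {m n : ℕ} (φ : (FI.mk m : FI G) ⟶ FI.mk n) {x : V.obj (FI.mk m)},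
    x ∈ deg m → act V φ x ∈ deg n

namespace Sub

variable {V : FIModule G k} (A : Sub V)

/-- A submodule as an `FI_G`-module. -/
def module : FIModule G k where
  obj Y := ModuleCat.of k (A.deg Y.card)
  map {X Y} φ := ModuleCat.ofHom
    ((act V (m := X.card) (n := Y.card) φ).restrict fun _ hx => A.act_mem φ hx)
  map_id X := by
    ext x
    exact act_id V (n := X.card) x.1
  map_comp {X Y Z} φ ψ := by
    ext x
    exact (act_act V (l := X.card) (m := Y.card) (n := Z.card) φ ψ x.1).symm

/-- The inclusion of a submodule. -/
def incl : A.module ⟶ V := homMk (V := A.module) (fun n => (A.deg n).subtype) fun _ _ => rfl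

lemma incl_injective (n : ℕ) : Function.Injective (comp A.incl n) := Subtype.val_injective

/-- Morphisms into a submodule. -/
def lift {U : FIModule G k} (α : U ⟶ V) (h : ∀ n x, comp α n x ∈ A.deg n) : U ⟶ A.module :=
  homMk (U := A.module) (fun n => (comp α n).codRestrict (A.deg n) (h n))
    fun φ x => Subtype.ext (comp_act α φ x)

lemma lift_incl {U : FIModule G k} (α : U ⟶ V) (h : ∀ n x, comp α n x ∈ A.deg n) :
    A.lift α h ≫ A.incl = α := rfl

/-- The quotient of an `FI_G`-module by a submodule. -/
def quot : FIModule G k where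
  obj Y := ModuleCat.of k (V.obj (FI.mk Y.card) ⧸ A.deg Y.card)
  map {X Y} φ := ModuleCat.ofHom
    (Submodule.mapQ _ _ (act V (m := X.card) (n := Y.card) φ) fun _ hx => A.act_mem φ hx)
  map_id X := by
    ext x
    exact congrArg (Submodule.Quotient.mk (p := A.deg X.card)) (act_id V x)
  map_comp {X Y Z} φ ψ := by
    ext x
    exact congrArg (Submodule.Quotient.mk (p := A.deg Z.card))
      (act_act V (l := X.card) (m := Y.card) (n := Z.card) φ ψ x).symm

/-- The projection onto a quotient. -/
def proj : V ⟶ A.quot := homMk (U := A.quot) (fun n => (A.deg n).mkQ) fun _ _ => rfl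

lemma proj_surjective (n : ℕ) : Function.Surjective (comp A.proj n) :=
  Submodule.mkQ_surjective _

lemma proj_eq_zero_iff {n : ℕ} {x : V.obj (FI.mk n)} : comp A.proj n x = 0 ↔ x ∈ A.deg n :=
  Submodule.Quotient.mk_eq_zero _

/-- Morphisms out of a quotient. -/
def desc {U : FIModule G k} (α : V ⟶ U) (h : ∀ n, ∀ x ∈ A.deg n, comp α n x = 0) :
    A.quot ⟶ U :=
  homMk (V := A.quot) (fun n => (A.deg n).liftQ (comp α n) (h n)) fun φ x => by
    obtain ⟨y, rfl⟩ := Submodule.mkQ_surjective _ x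
    exact comp_act α φ y

end Sub

/-- The kernel of a morphism, as a submodule. -/
def kerSub {V U : FIModule G k} (α : V ⟶ U) : Sub V where
  deg n := LinearMap.ker (comp α n)
  act_mem φ x hx := by
    rw [LinearMap.mem_ker] at hx ⊢
    rw [comp_act, hx, map_zero]

/-- The image of a morphism, as a submodule. -/
def rangeSub {V U : FIModule G k} (α : V ⟶ U) : Sub U where
  deg n := LinearMap.range (comp α n)
  act_mem φ x hx := by
    obtain ⟨y, rfl⟩ := hx
    exact ⟨act V φ y, comp_act α φ y⟩

/-- The corestriction of a morphism to its image. -/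
def toRange {V U : FIModule G k} (α : V ⟶ U) : V ⟶ (rangeSub α).module :=
  (rangeSub α).lift α fun _ x => ⟨x, rfl⟩

lemma toRange_surjective {V U : FIModule G k} (α : V ⟶ U) (n : ℕ) :
    Function.Surjective (comp (toRange α) n) := by
  rintro ⟨_, x, rfl⟩
  exact ⟨x, rfl⟩

lemma toRange_eq_zero_iff {V U : FIModule G k} (α : V ⟶ U) {n : ℕ} {x : V.obj (FI.mk n)} :
    comp (toRange α) n x = 0 ↔ comp α n x = 0 :=
  Subtype.ext_iff

/-! ### The shift functor and the derivative -/

/-- The endofunctor `[n] ↦ [n + 1]` of `FI_G` which adds the new point `0`. -/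
def shift (G : Type u) [Group G] : FI G ⥤ FI G where
  obj X := FI.mk (X.card + 1)
  map {X Y} φ := FIHom.mk
    ⟨Fin.cases 0 fun i => (φ.f i).succ, fun i j => by
      cases i using Fin.cases <;> cases j using Fin.cases <;>
        simp [Fin.succ_ne_zero, (Fin.succ_ne_zero _).symm]⟩
    (Fin.cases 1 φ.g)
  map_id X := by
    apply FIHom.ext
    · ext i
      cases i using Fin.cases <;> rfl
    · funext i
      cases i using Fin.cases <;> rfl
  map_comp {X Y Z} φ ψ := by
    apply FIHom.ext
    · ext i
      cases i using Fin.cases <;> rfl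
    · funext i
      cases i using Fin.cases
      · exact (one_mul (1 : G)).symm
      · rfl

/-- The morphism `[m + 1] ⟶ [n + 1]` obtained from `[m] ⟶ [n]` by adding the point `0`. -/
abbrev shiftMap {m n : ℕ} (φ : (FI.mk m : FI G) ⟶ FI.mk n) :
    (FI.mk (m + 1) : FI G) ⟶ FI.mk (n + 1) := (shift G).map φ

/-- The standard inclusion `[n] ⟶ [n + 1]` missing the point `0`. -/
def std (G : Type u) [Group G] (n : ℕ) : (FI.mk n : FI G) ⟶ FI.mk (n + 1) :=
  FIHom.mk (Fin.succEmb n) fun _ => 1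

lemma std_shiftMap {m n : ℕ} (φ : (FI.mk m : FI G) ⟶ FI.mk n) :
    std G m ≫ shiftMap φ = φ ≫ std G n := by
  apply FIHom.ext
  · rfl
  · funext i
    exact (one_mul (φ.g i)).trans (mul_one (φ.g i)).symm

/-- The transposition of the two new points of `[n + 2]`. -/
def twist (G : Type u) [Group G] (n : ℕ) : (FI.mk (n + 2) : FI G) ⟶ FI.mk (n + 2) :=
  FIHom.mk ⟨Fin.cases (Fin.succ 0) (Fin.cases 0 fun j => j.succ.succ),
    Function.Involutive.injective fun i => by
      cases i using Fin.cases with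
      | zero => rfl
      | succ i => cases i using Fin.cases <;> rfl⟩ fun _ => 1

/-- The shifted module `n ↦ V_{n + 1}`. -/
abbrev shifted (V : FIModule G k) : FIModule G k := shift G ⋙ V

/-- The natural map `V ⟶ ΣV` induced by the standard inclusions. -/
def toShifted (V : FIModule G k) : V ⟶ shifted V :=
  homMk (U := shifted V) (fun n => act V (std G n)) fun {m n} φ x =>
    (act_act V φ (std G n) x).trans ((congrArg (fun χ => act V χ x) (std_shiftMap φ).symm).trans
      (act_act V (std G m) (shiftMap φ) x).symm)

/-- The derivative `DV`, the cokernel of `V ⟶ ΣV`. -/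
def derivative (V : FIModule G k) : FIModule G k := (rangeSub (toShifted V)).quot

/-- The class in `DV_n = V_{n + 1} / V_n` of an element of `V_{n + 1}`. -/
def cls (V : FIModule G k) (n : ℕ) : V.obj (FI.mk (n + 1)) →ₗ[k] (derivative V).obj (FI.mk n) :=
  comp (rangeSub (toShifted V)).proj n

lemma cls_surjective (V : FIModule G k) (n : ℕ) : Function.Surjective (cls V n) :=
  Sub.proj_surjective _ n

lemma cls_eq_zero_iff {V : FIModule G k} {n : ℕ} {x : V.obj (FI.mk (n + 1))} :
    cls V n x = 0 ↔ ∃ y, act V (std G n) y = x :=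
  Sub.proj_eq_zero_iff _

lemma act_cls (V : FIModule G k) {m n : ℕ} (φ : (FI.mk m : FI G) ⟶ FI.mk n)
    (x : V.obj (FI.mk (m + 1))) :
    act (derivative V) φ (cls V m x) = cls V n (act V (shiftMap φ) x) :=
  rfl

/-- The map on derivatives induced by a morphism. -/
def derivMap {V U : FIModule G k} (α : V ⟶ U) : derivative V ⟶ derivative U :=
  Sub.desc _ (Functor.whiskerLeft (shift G) α ≫ Sub.proj _) fun n x hx => by
    obtain ⟨y, rfl⟩ := hx
    exact cls_eq_zero_iff.2 ⟨comp α n y, (comp_act α (std G n) y).symm⟩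

lemma comp_derivMap {V U : FIModule G k} (α : V ⟶ U) {n : ℕ} (x : V.obj (FI.mk (n + 1))) :
    comp (derivMap α) n (cls V n x) = cls U n (comp α (n + 1) x) := rfl

/-- A morphism `[m] ⟶ [n + 1]` either misses `0`, or is, up to an endomorphism of the source,
obtained by adding the point `0` to a morphism. -/
lemma factor_through_std_or_shift {m n : ℕ} (φ : (FI.mk m : FI G) ⟶ FI.mk (n + 1)) :
    (∃ ψ : (FI.mk m : FI G) ⟶ FI.mk n, φ = ψ ≫ std G n) ∨
    ∃ (l : ℕ) (σ : (FI.mk m : FI G) ⟶ FI.mk (l + 1)) (ψ : (FI.mk l : FI G) ⟶ FI.mk n),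
      m = l + 1 ∧ φ = σ ≫ shiftMap ψ := by
  by_cases h : ∃ i : Fin m, φ.f i = 0
  · right
    obtain ⟨i, hi⟩ := h
    obtain ⟨l, rfl⟩ : ∃ l, m = l + 1 := ⟨m - 1, by have := i.2; omega⟩
    have hne : ∀ j : Fin l, φ.f (Equiv.swap i 0 j.succ) ≠ 0 := fun j hj => by
      have h1 := φ.f.injective (hj.trans hi.symm)
      have h2 : j.succ = 0 := by
        rw [Equiv.swap_apply_eq_iff] at h1
        simp at h1
      exact Fin.succ_ne_zero j h2
    refine ⟨l, FIHom.mk (Equiv.swap i 0).toEmbedding (fun x => if x = i then φ.g i else 1),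
      FIHom.mk ⟨fun j => (φ.f (Equiv.swap i 0 j.succ)).pred (hne j), fun a b hab => ?_⟩
        (fun j => φ.g (Equiv.swap i 0 j.succ)), rfl, ?_⟩
    · have := φ.f.injective (Fin.pred_inj.1 hab)
      exact Fin.succ_injective _ ((Equiv.swap i 0).injective this)
    · apply FIHom.ext
      · ext x
        change (φ.f x : ℕ) = (Fin.cases (motive := fun _ => Fin (n + 1)) 0
          (fun j => ((φ.f (Equiv.swap i 0 j.succ)).pred (hne j)).succ) (Equiv.swap i 0 x) :
            Fin (n + 1))
        by_cases hx : x = i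
        · subst hx
          simp [hi]
        · obtain ⟨j, hj⟩ : ∃ j : Fin l, Equiv.swap i 0 x = j.succ :=
            Fin.exists_succ_eq.2 (by
              intro h0
              rw [Equiv.swap_apply_eq_iff] at h0
              exact hx (by simpa using h0)) |>.imp fun _ => Eq.symm
          have : Equiv.swap i 0 j.succ = x := by rw [← hj]; simp
          rw [hj]
          simp [this]
      · funext x
        change φ.g x = (if x = i then φ.g i else 1) * (Fin.cases (motive := fun _ => G) 1
          (fun j => φ.g (Equiv.swap i 0 j.succ)) (Equiv.swap i 0 x) : G)
        by_cases hx : x = i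
        · subst hx
          simp
        · obtain ⟨j, hj⟩ : ∃ j : Fin l, Equiv.swap i 0 x = j.succ :=
            Fin.exists_succ_eq.2 (by
              intro h0
              rw [Equiv.swap_apply_eq_iff] at h0
              exact hx (by simpa using h0)) |>.imp fun _ => Eq.symm
          have : Equiv.swap i 0 j.succ = x := by rw [← hj]; simp
          rw [hj]
          simp [this, hx]
  · left
    push Not at h
    refine ⟨FIHom.mk ⟨fun j => (φ.f j).pred (h j), fun a b hab =>
      φ.f.injective (Fin.pred_inj.1 hab)⟩ φ.g, ?_⟩
    apply FIHom.ext
    · ext x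
      change (φ.f x : ℕ) = (((φ.f x).pred (h x)).succ : Fin (n + 1))
      simp
    · funext x
      exact (mul_one (φ.g x)).symm

/-- The derivative shifts `H_0`: `H_0(DV)_n = H_0(V)_{n + 1}`. -/
lemma cls_mem_lower_iff {V : FIModule G k} {n : ℕ} {x : V.obj (FI.mk (n + 1))} :
    cls V n x ∈ lower (derivative V) n ↔ x ∈ lower V (n + 1) := by
  constructor
  · intro h
    have hle : lower (derivative V) n ≤ (lower V (n + 1)).map (cls V n) := by
      refine lower_le _ n _ fun m hm φ y => ?_
      obtain ⟨z, rfl⟩ := cls_surjective V m y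
      exact ⟨_, act_mem_lower V (Nat.succ_lt_succ hm) (shiftMap φ) z, (act_cls V φ z).symm⟩
    obtain ⟨z, hz, hzx⟩ := hle h
    obtain ⟨y, hy⟩ := cls_eq_zero_iff.1 (show cls V n (x - z) = 0 by rw [map_sub, hzx, sub_self])
    rw [← sub_add_cancel x z, ← hy]
    exact add_mem (act_mem_lower V n.lt_succ_self _ y) hz
  · intro h
    have hle : lower V (n + 1) ≤ (lower (derivative V) n).comap (cls V n) := by
      refine lower_le _ _ _ fun m hm φ y => ?_
      change cls V n (act V φ y) ∈ lower (derivative V) n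
      rcases factor_through_std_or_shift φ with ⟨ψ, rfl⟩ | ⟨l, σ, ψ, rfl, rfl⟩
      · rw [← act_act, cls_eq_zero_iff.2 ⟨_, rfl⟩]
        exact zero_mem _
      · rw [← act_act, ← act_cls]
        exact act_mem_lower _ (Nat.lt_of_succ_lt_succ hm) ψ _
    exact hle h

/-! ### Derivative-torsion-free modules -/

/-- `X → Y → Z → 0` is exact, and `X → Y` is injective in degrees `≤ n`. -/
structure ExactUpTo {X Y Z : FIModule G k} (α : X ⟶ Y) (β : Y ⟶ Z) (n : ℕ) : Prop where
  surj : ∀ m, Function.Surjective (comp β m)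
  exact : ∀ m (y : Y.obj (FI.mk m)), comp β m y = 0 ↔ ∃ x, comp α m x = y
  inj : ∀ m ≤ n, Function.Injective (comp α m)

/-- The condition that the maps `D^a V → Σ D^a V` are injective in all degrees `m` with
`m + a < n`. -/
def TorsionFreeBelow : ℕ → FIModule G k → Prop
  | 0, _ => True
  | n + 1, V => (∀ m ≤ n, Function.Injective (act V (std G m))) ∧ TorsionFreeBelow n (derivative V)

/-- `V` is derivative-torsion-free: all the maps `D^a V → Σ D^a V` are injective. -/
def DerivTorsionFree (V : FIModule G k) : Prop := ∀ n, TorsionFreeBelow n V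

lemma TorsionFreeBelow.std_injective {n m : ℕ} {V : FIModule G k} (h : TorsionFreeBelow n V)
    (hm : m < n) : Function.Injective (act V (std G m)) := by
  cases n with
  | zero => exact absurd hm (Nat.not_lt_zero _)
  | succ n => exact h.1 m (Nat.le_of_lt_succ hm)

lemma TorsionFreeBelow.eq_zero {n m : ℕ} {V : FIModule G k} (h : TorsionFreeBelow n V)
    (hm : m < n) {x : V.obj (FI.mk m)} (hx : act V (std G m) x = 0) : x = 0 :=
  (injective_iff_map_eq_zero _).1 (h.std_injective hm) x hx

lemma DerivTorsionFree.std_injective {V : FIModule G k} (h : DerivTorsionFree V) (m : ℕ) :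
    Function.Injective (act V (std G m)) := (h (m + 1)).std_injective m.lt_succ_self

lemma DerivTorsionFree.deriv {V : FIModule G k} (h : DerivTorsionFree V) :
    DerivTorsionFree (derivative V) := fun n => (h (n + 1)).2

lemma ExactUpTo.comp_comp_eq_zero {X Y Z : FIModule G k} {α : X ⟶ Y} {β : Y ⟶ Z} {n : ℕ}
    (h : ExactUpTo α β n) {m : ℕ} (x : X.obj (FI.mk m)) : comp β m (comp α m x) = 0 :=
  (h.exact m _).2 ⟨x, rfl⟩

lemma ExactUpTo.eq_zero {X Y Z : FIModule G k} {α : X ⟶ Y} {β : Y ⟶ Z} {n : ℕ}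
    (h : ExactUpTo α β n) {m : ℕ} (hm : m ≤ n) {x : X.obj (FI.mk m)} (hx : comp α m x = 0) :
    x = 0 :=
  (injective_iff_map_eq_zero _).1 (h.inj m hm) x hx

lemma derivMap_surjective {Y Z : FIModule G k} {β : Y ⟶ Z}
    (h : ∀ m, Function.Surjective (comp β m)) (m : ℕ) :
    Function.Surjective (comp (derivMap β) m) := fun z => by
  obtain ⟨z, rfl⟩ := cls_surjective Z m z
  obtain ⟨y, rfl⟩ := h (m + 1) z
  exact ⟨cls Y m y, comp_derivMap β y⟩

/-- The derivative is right exact, whether or not the cokernel has torsion. -/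
lemma ExactUpTo.derivMap_eq_zero_iff {X Y Z : FIModule G k} {α : X ⟶ Y} {β : Y ⟶ Z} {n : ℕ}
    (h : ExactUpTo α β n) (m : ℕ) (y : (derivative Y).obj (FI.mk m)) :
    comp (derivMap β) m y = 0 ↔ ∃ x, comp (derivMap α) m x = y := by
  obtain ⟨y, rfl⟩ := cls_surjective Y m y
  constructor
  · intro hy
    obtain ⟨z, hz⟩ := cls_eq_zero_iff.1 ((comp_derivMap β y).symm.trans hy)
    obtain ⟨y', rfl⟩ := h.surj m z
    rw [← comp_act, ← sub_eq_zero, ← map_sub] at hz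
    obtain ⟨x, hx⟩ := (h.exact _ _).1 hz
    refine ⟨- cls X m x, ?_⟩
    rw [map_neg, comp_derivMap, hx, map_sub, cls_eq_zero_iff.2 ⟨y', rfl⟩, zero_sub, neg_neg]
  · rintro ⟨x, hx⟩
    obtain ⟨x, rfl⟩ := cls_surjective X m x
    rw [← hx, comp_derivMap, comp_derivMap, h.comp_comp_eq_zero, map_zero]

/-- Taking derivatives is exact as long as the cokernel is torsion-free. -/
lemma ExactUpTo.deriv {X Y Z : FIModule G k} {α : X ⟶ Y} {β : Y ⟶ Z} {n : ℕ}
    (h : ExactUpTo α β (n + 1)) (hZ : ∀ m ≤ n, Function.Injective (act Z (std G m))) :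
    ExactUpTo (derivMap α) (derivMap β) n where
  surj := derivMap_surjective h.surj
  exact := h.derivMap_eq_zero_iff
  inj m hm := by
    refine (injective_iff_map_eq_zero _).2 fun x hx => ?_
    obtain ⟨x, rfl⟩ := cls_surjective X m x
    obtain ⟨y, hy⟩ := cls_eq_zero_iff.1 ((comp_derivMap α x).symm.trans hx)
    have hz : comp β m y = 0 := by
      refine (injective_iff_map_eq_zero _).1 (hZ m hm) _ ?_
      rw [← comp_act, hy, h.comp_comp_eq_zero]
    obtain ⟨x', rfl⟩ := (h.exact m y).1 hz
    refine cls_eq_zero_iff.2 ⟨x', h.inj (m + 1) (Nat.succ_le_succ hm) ?_⟩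
    rw [comp_act, hy]

/-- If `Z` is torsion-free in the relevant range then `H_0(X)_n → H_0(Y)_n` is injective: by
`cls_mem_lower_iff` this is the statement that the `n`-th derivative of `X → Y` is injective in
degree `0`. -/
lemma ExactUpTo.mem_lower {n : ℕ} : ∀ {X Y Z : FIModule G k} {α : X ⟶ Y} {β : Y ⟶ Z},
    ExactUpTo α β n → TorsionFreeBelow n Z → ∀ {x : X.obj (FI.mk n)},
    comp α n x ∈ lower Y n → x ∈ lower X n := by
  induction n with
  | zero =>
    intro X Y Z α β h _ x hx
    rw [lower_zero, Submodule.mem_bot] at hx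
    rw [h.eq_zero le_rfl hx]
    exact zero_mem _
  | succ n ih =>
    intro X Y Z α β h hZ x hx
    rw [← cls_mem_lower_iff] at hx ⊢
    exact ih (h.deriv hZ.1) hZ.2 hx

lemma ExactUpTo.torsionFreeBelow_left {n : ℕ} : ∀ {X Y Z : FIModule G k} {α : X ⟶ Y} {β : Y ⟶ Z},
    ExactUpTo α β n → TorsionFreeBelow n Y → TorsionFreeBelow n Z → TorsionFreeBelow n X := by
  induction n with
  | zero => intros; trivial
  | succ n ih =>
    intro X Y Z α β h hY hZ
    refine ⟨fun m hm => (injective_iff_map_eq_zero _).2 fun x hx => ?_,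
      ih (h.deriv hZ.1) hY.2 hZ.2⟩
    refine h.eq_zero (by omega) (hY.eq_zero (Nat.lt_succ_of_le hm) ?_)
    rw [← comp_act, hx, map_zero]

lemma ExactUpTo.torsionFreeBelow_middle {n : ℕ} :
    ∀ {X Y Z : FIModule G k} {α : X ⟶ Y} {β : Y ⟶ Z},
    ExactUpTo α β n → TorsionFreeBelow n X → TorsionFreeBelow n Z → TorsionFreeBelow n Y := by
  induction n with
  | zero => intros; trivial
  | succ n ih =>
    intro X Y Z α β h hX hZ
    refine ⟨fun m hm => (injective_iff_map_eq_zero _).2 fun y hy => ?_,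
      ih (h.deriv hZ.1) hX.2 hZ.2⟩
    have hz : comp β m y = 0 := by
      refine hZ.eq_zero (Nat.lt_succ_of_le hm) ?_
      rw [← comp_act, hy, map_zero]
    obtain ⟨x, rfl⟩ := (h.exact m y).1 hz
    rw [← comp_act] at hy
    rw [hX.eq_zero (Nat.lt_succ_of_le hm) (h.eq_zero (Nat.succ_le_succ hm) hy), map_zero]

/-- `0 → X → Y → Z → 0` is exact. -/
def IsExact {X Y Z : FIModule G k} (α : X ⟶ Y) (β : Y ⟶ Z) : Prop := ∀ n, ExactUpTo α β n

lemma IsExact.deriv {X Y Z : FIModule G k} {α : X ⟶ Y} {β : Y ⟶ Z} (h : IsExact α β)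
    (hZ : ∀ m, Function.Injective (act Z (std G m))) : IsExact (derivMap α) (derivMap β) :=
  fun n => (h (n + 1)).deriv fun m _ => hZ m

lemma IsExact.derivTorsionFree_left {X Y Z : FIModule G k} {α : X ⟶ Y} {β : Y ⟶ Z}
    (h : IsExact α β) (hY : DerivTorsionFree Y) (hZ : DerivTorsionFree Z) : DerivTorsionFree X :=
  fun n => (h n).torsionFreeBelow_left (hY n) (hZ n)

lemma IsExact.derivTorsionFree_middle {X Y Z : FIModule G k} {α : X ⟶ Y} {β : Y ⟶ Z}
    (h : IsExact α β) (hX : DerivTorsionFree X) (hZ : DerivTorsionFree Z) : DerivTorsionFree Y :=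
  fun n => (h n).torsionFreeBelow_middle (hX n) (hZ n)

/-- The kernel of `Z → ΣZ` embeds into `DX` as a submodule on which the standard inclusions
vanish, so that it is zero if `DX` is torsion-free. -/
lemma IsExact.std_injective_right {X Y Z : FIModule G k} {α : X ⟶ Y} {β : Y ⟶ Z}
    (h : IsExact α β) (hX : DerivTorsionFree X) (hY : DerivTorsionFree Y) (m : ℕ) :
    Function.Injective (act Z (std G m)) := by
  refine (injective_iff_map_eq_zero _).2 fun z hz => ?_
  obtain ⟨y, rfl⟩ := (h 0).surj m z
  rw [← comp_act] at hz
  obtain ⟨x, hx⟩ := ((h 0).exact _ _).1 hz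
  have hxx : act X (shiftMap (std G m)) x = act X (std G (m + 1)) x := by
    refine (h (m + 2)).inj (m + 2) le_rfl ?_
    rw [comp_act, comp_act, hx, act_act, act_act, std_shiftMap]
  have hcls : cls X m x = 0 := by
    refine (injective_iff_map_eq_zero _).1 (hX.deriv.std_injective m) _ ?_
    rw [act_cls]
    exact cls_eq_zero_iff.2 ⟨x, hxx.symm⟩
  obtain ⟨x', rfl⟩ := cls_eq_zero_iff.1 hcls
  rw [comp_act] at hx
  rw [← hY.std_injective m hx, (h 0).comp_comp_eq_zero]

lemma IsExact.derivTorsionFree_right {X Y Z : FIModule G k} {α : X ⟶ Y} {β : Y ⟶ Z}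
    (h : IsExact α β) (hX : DerivTorsionFree X) (hY : DerivTorsionFree Y) :
    DerivTorsionFree Z := by
  intro n
  induction n generalizing X Y Z with
  | zero => trivial
  | succ n ih =>
    exact ⟨fun m _ => h.std_injective_right hX hY m,
      ih (h.deriv (h.std_injective_right hX hY)) hX.deriv hY.deriv⟩

lemma isExact_incl_of_range {X Y Z : FIModule G k} (α : X ⟶ Y) (β : Y ⟶ Z)
    (surj : ∀ m, Function.Surjective (comp β m))
    (exact : ∀ m (y : Y.obj (FI.mk m)), comp β m y = 0 ↔ ∃ x, comp α m x = y) :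
    IsExact (rangeSub α).incl β := fun _ =>
  ⟨surj, fun m y => (exact m y).trans ⟨fun h => ⟨⟨y, h⟩, rfl⟩, fun ⟨x, hx⟩ => hx ▸ x.2⟩,
    fun m _ => Sub.incl_injective _ m⟩

lemma Sub.isExact_proj {V : FIModule G k} (A : Sub V) : IsExact A.incl A.proj := fun _ =>
  ⟨A.proj_surjective, fun _ y => A.proj_eq_zero_iff.trans
    ⟨fun h => ⟨⟨y, h⟩, rfl⟩, fun ⟨x, hx⟩ => hx ▸ x.2⟩, fun m _ => A.incl_injective m⟩

lemma isExact_kerSub {X Y : FIModule G k} (α : X ⟶ Y)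
    (surj : ∀ m, Function.Surjective (comp α m)) : IsExact (kerSub α).incl α := fun _ =>
  ⟨surj, fun _ y => ⟨fun h => ⟨⟨y, h⟩, rfl⟩, fun ⟨x, hx⟩ => hx ▸ x.2⟩,
    fun m _ => Sub.incl_injective _ m⟩

/-- Suppose that `0 → K → P → V → 0` is exact, `P` is derivative-torsion-free, and
`H_0(K) → H_0(P)` is injective, i.e. `H_1(V) = 0` when `P` is projective. Then `V` is
derivative-torsion-free. The hypotheses pass to `DV`, presented by `DP` with the image `E` of `DK`
as kernel. The kernel `N` of `DK → E` measures the torsion in `V`; it vanishes below the degree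
`n` under consideration, and an element of `N_n` coming from torsion in `V` lies in the lower part
of `DK`, hence in that of `N` by `ExactUpTo.mem_lower` applied to `N → DK → E`. -/
theorem IsExact.derivTorsionFree_of_mem_lower {K P V : FIModule G k} {α : K ⟶ P} {β : P ⟶ V}
    (h : IsExact α β) (hP : DerivTorsionFree P)
    (hK : ∀ n (x : K.obj (FI.mk n)), comp α n x ∈ lower P n → x ∈ lower K n) :
    DerivTorsionFree V := by
  intro n
  induction n generalizing K P V with
  | zero => trivial
  | succ n ih =>
    have hV : TorsionFreeBelow n V := ih h hP hK
    have hE : IsExact (rangeSub (derivMap α)).incl (derivMap β) :=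
      isExact_incl_of_range _ _ (derivMap_surjective (h 0).surj) (h 0).derivMap_eq_zero_iff
    have hDV : TorsionFreeBelow n (derivative V) := by
      refine ih hE hP.deriv ?_
      rintro m ⟨_, x, rfl⟩ hx
      obtain ⟨x, rfl⟩ := cls_surjective K m x
      have h1 : cls P m (comp α (m + 1) x) ∈ lower (derivative P) m := hx
      have h2 := cls_mem_lower_iff.2 (hK _ _ (cls_mem_lower_iff.1 h1))
      exact comp_mem_lower (toRange (derivMap α)) h2
    refine ⟨fun m hm => ?_, hDV⟩
    obtain hm | rfl := hm.lt_or_eq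
    · exact hV.std_injective hm
    have hE' : TorsionFreeBelow m (rangeSub (derivMap α)).module :=
      (hE m).torsionFreeBelow_left (hP.deriv m) hDV
    refine (injective_iff_map_eq_zero _).2 fun v hv => ?_
    obtain ⟨p, rfl⟩ := (h 0).surj m v
    rw [← comp_act] at hv
    obtain ⟨x, hx⟩ := ((h 0).exact _ _).1 hv
    have hx0 : comp (derivMap α) m (cls K m x) = 0 := by
      rw [comp_derivMap, hx]
      exact cls_eq_zero_iff.2 ⟨p, rfl⟩
    have hxl : cls K m x ∈ lower (derivative K) m := by
      refine cls_mem_lower_iff.2 (hK _ _ ?_)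
      rw [hx]
      exact act_mem_lower P m.lt_succ_self _ p
    have hN := isExact_kerSub (toRange (derivMap α)) (toRange_surjective _)
    have hN0 : ∀ l < m, ∀ y : (kerSub (toRange (derivMap α))).module.obj (FI.mk l), y = 0 := by
      rintro l hl ⟨y, hy⟩
      obtain ⟨y, rfl⟩ := cls_surjective K l y
      refine Subtype.ext ?_
      obtain ⟨q, hq⟩ := cls_eq_zero_iff.1
        ((comp_derivMap α y).symm.trans ((toRange_eq_zero_iff _).1 hy))
      have hq0 : comp β l q = 0 := by
        refine hV.eq_zero hl ?_
        rw [← comp_act, hq, (h 0).comp_comp_eq_zero]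
      obtain ⟨y', rfl⟩ := ((h 0).exact _ _).1 hq0
      rw [← comp_act] at hq
      exact cls_eq_zero_iff.2 ⟨y', (h (l + 1)).inj (l + 1) le_rfl hq⟩
    have hxN : cls K m x = 0 := congrArg Subtype.val (eq_zero_of_mem_lower hN0
      ((hN m).mem_lower hE' (x := ⟨cls K m x, (toRange_eq_zero_iff _).2 hx0⟩) hxl))
    obtain ⟨x', rfl⟩ := cls_eq_zero_iff.1 hxN
    rw [comp_act] at hx
    rw [← hP.std_injective m hx, (h 0).comp_comp_eq_zero]

/-! ### Modules with a natural retraction of `V ⟶ ΣV` -/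

/-- The map `V ⟶ ΣV` has a retraction. -/
def SplitsShift (V : FIModule G k) : Prop :=
  ∃ ρ : shifted V ⟶ V, toShifted V ≫ ρ = 𝟙 V

lemma twist_shiftMap {m n : ℕ} (φ : (FI.mk m : FI G) ⟶ FI.mk n) :
    twist G m ≫ shiftMap (shiftMap φ) = shiftMap (shiftMap φ) ≫ twist G n := by
  apply FIHom.ext
  · ext i
    cases i using Fin.cases with
    | zero => rfl
    | succ i => cases i using Fin.cases <;> rfl
  · funext i
    cases i using Fin.cases with
    | zero => rfl
    | succ i => cases i using Fin.cases with
      | zero => rfl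
      | succ i => exact (one_mul (φ.g i)).trans (mul_one (φ.g i)).symm

lemma shiftMap_std_twist (n : ℕ) :
    shiftMap (std G n) ≫ twist G n = std G (n + 1) := by
  apply FIHom.ext
  · ext i
    cases i using Fin.cases <;> rfl
  · funext i
    cases i using Fin.cases <;> exact one_mul (1 : G)

lemma std_twist (n : ℕ) : std G (n + 1) ≫ twist G n = shiftMap (std G n) := by
  apply FIHom.ext
  · ext i
    cases i using Fin.cases <;> rfl
  · funext i
    cases i using Fin.cases <;> exact one_mul (1 : G)

/-- The derivative inherits the splitting: a retraction for `DV` is induced by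
`V_{n + 2} → V_{n + 2} → V_{n + 1}`, the transposition of the two new points followed by the
retraction for `V`. -/
lemma SplitsShift.deriv {V : FIModule G k} (h : SplitsShift V) : SplitsShift (derivative V) := by
  obtain ⟨ρ, hρ⟩ := h
  have hρ' : ∀ n (x : V.obj (FI.mk n)), comp ρ n (act V (std G n) x) = x := fun n x =>
    congrArg (fun χ => comp χ n x) hρ
  have hnat : ∀ {m n : ℕ} (φ : (FI.mk m : FI G) ⟶ FI.mk n) (x : V.obj (FI.mk (m + 1))),
    comp ρ n (act V (shiftMap φ) x) = act V φ (comp ρ m x) := fun φ x => comp_act ρ φ x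
  let r : ∀ n, (shifted (derivative V)).obj (FI.mk n) →ₗ[k]
      (derivative V).obj (FI.mk n) := fun n =>
    Submodule.liftQ _ (cls V n ∘ₗ comp ρ (n + 1) ∘ₗ act V (twist G n)) (by
      rintro _ ⟨(x : V.obj (FI.mk (n + 1))), rfl⟩
      change cls V n (comp ρ (n + 1) (act V (twist G n) (act V (std G (n + 1)) x))) = 0
      rw [act_act, std_twist, hnat]
      exact cls_eq_zero_iff.2 ⟨_, rfl⟩)
  have hr : ∀ n (x : V.obj (FI.mk (n + 2))),
    r n (cls V (n + 1) x) = cls V n (comp ρ (n + 1) (act V (twist G n) x)) := fun _ _ => rfl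
  refine ⟨homMk (V := shifted (derivative V)) r fun {m n} φ x => ?_, hom_ext' fun n x => ?_⟩
  · obtain ⟨x, rfl⟩ := cls_surjective V (m + 1) x
    change r n (cls V (n + 1) (act V (shiftMap (shiftMap φ)) x)) = _
    rw [hr, hr, act_cls, act_act, ← twist_shiftMap, ← act_act, hnat]
  · obtain ⟨x, rfl⟩ := cls_surjective V n x
    change r n (cls V (n + 1) (act V (shiftMap (std G n)) x)) = cls V n x
    rw [hr, act_act, shiftMap_std_twist, hρ']

lemma SplitsShift.derivTorsionFree {V : FIModule G k} (h : SplitsShift V) :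
    DerivTorsionFree V := by
  intro n
  induction n generalizing V with
  | zero => trivial
  | succ n ih =>
    refine ⟨fun m _ => ?_, ih h.deriv⟩
    obtain ⟨ρ, hρ⟩ := h
    exact Function.LeftInverse.injective (g := comp ρ m) fun x =>
      congrArg (fun χ => comp χ m x) hρ

lemma toShifted_naturality {V U : FIModule G k} (α : V ⟶ U) :
    toShifted V ≫ Functor.whiskerLeft (shift G) α = α ≫ toShifted U :=
  hom_ext' fun n x => comp_act α (std G n) x

lemma SplitsShift.of_retract {V U : FIModule G k} (h : SplitsShift U) (i : V ⟶ U) (r : U ⟶ V)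
    (hir : i ≫ r = 𝟙 V) : SplitsShift V := by
  obtain ⟨ρ, hρ⟩ := h
  refine ⟨Functor.whiskerLeft (shift G) i ≫ ρ ≫ r, ?_⟩
  rw [← Category.assoc, toShifted_naturality, Category.assoc, reassoc_of% hρ, hir]

lemma SplitsShift.sigma {ι : Type*} [HasColimitsOfShape (Discrete ι) (ModuleCat.{u} k)]
    (V : ι → FIModule G k) (h : ∀ i, SplitsShift (V i)) : SplitsShift (∐ V) := by
  choose ρ hρ using h
  let F : FIModule G k ⥤ FIModule G k := (Functor.whiskeringLeft _ _ _).obj (shift G)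
  let hc := isColimitOfHasCoproductOfPreservesColimit F V
  refine ⟨Cofan.IsColimit.desc hc fun i => ρ i ≫ Sigma.ι V i, Sigma.hom_ext _ _ fun i => ?_⟩
  rw [← Category.assoc, ← toShifted_naturality, Category.assoc, Category.comp_id]
  have h1 : F.map (Sigma.ι V i) ≫ Cofan.IsColimit.desc hc (fun i => ρ i ≫ Sigma.ι V i) =
    ρ i ≫ Sigma.ι V i := Cofan.IsColimit.fac hc _ i
  exact (congrArg (toShifted (V i) ≫ ·) h1).trans (by rw [← Category.assoc, hρ, Category.id_comp])

/-! ### Relatively projective modules -/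

lemma std_cancel {n m : ℕ} {φ ψ : (FI.mk n : FI G) ⟶ FI.mk m}
    (h : φ ≫ std G m = ψ ≫ std G m) : φ = ψ := by
  apply FIHom.ext
  · ext i
    have h1 := congrArg (fun χ : FIHom G n (m + 1) => (χ.f i).val) h
    exact Nat.succ_injective h1
  · funext i
    have h1 := congrArg (fun χ : FIHom G n (m + 1) => χ.g i) h
    exact (mul_one (φ.g i)).symm.trans (h1.trans (mul_one (ψ.g i)))

lemma exists_eq_comp_std_iff {n m : ℕ} (φ : (FI.mk n : FI G) ⟶ FI.mk (m + 1)) :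
    (∃ ψ : (FI.mk n : FI G) ⟶ FI.mk m, ψ ≫ std G m = φ) ↔ ∀ i, φ.f i ≠ 0 := by
  constructor
  · rintro ⟨ψ, rfl⟩ i
    exact Fin.succ_ne_zero (ψ.f i)
  · intro h
    rcases factor_through_std_or_shift φ with ⟨ψ, rfl⟩ | ⟨l, σ, ψ, rfl, rfl⟩
    · exact ⟨ψ, rfl⟩
    · obtain ⟨i, hi⟩ := Finite.surjective_of_injective σ.f.injective 0
      refine absurd ?_ (h i)
      change (shiftMap ψ).f (σ.f i) = 0
      rw [hi]
      rfl

open Classical in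
/-- The map `k[Hom([n], [m + 1])] → k[Hom([n], [m])]` which is the identity on the morphisms missing
`0` and vanishes on the others. -/
def cut (G : Type u) [Group G] (k : Type u) [CommRing k] (n m : ℕ) :
    (((FI.mk n : FI G) ⟶ FI.mk (m + 1)) →₀ k) →ₗ[k] (((FI.mk n : FI G) ⟶ FI.mk m) →₀ k) :=
  Finsupp.linearCombination k fun φ =>
    if h : ∃ ψ : (FI.mk n : FI G) ⟶ FI.mk m, ψ ≫ std G m = φ then Finsupp.single h.choose 1 else 0

lemma cut_comp_std {n m : ℕ} (ψ : (FI.mk n : FI G) ⟶ FI.mk m) :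
    cut G k n m (Finsupp.single (ψ ≫ std G m) 1) = Finsupp.single ψ 1 := by
  have h : ∃ χ : (FI.mk n : FI G) ⟶ FI.mk m, χ ≫ std G m = ψ ≫ std G m := ⟨ψ, rfl⟩
  rw [cut, Finsupp.linearCombination_single, one_smul, dif_pos h, std_cancel h.choose_spec]

lemma cut_of_eq_zero {n m : ℕ} (φ : (FI.mk n : FI G) ⟶ FI.mk (m + 1)) {i : Fin n}
    (hi : φ.f i = 0) : cut G k n m (Finsupp.single φ 1) = 0 := by
  rw [cut, Finsupp.linearCombination_single, one_smul,
    dif_neg fun h => (exists_eq_comp_std_iff φ).1 h i hi]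

/-- The class of `w ⊗ φ` in `M(W_n)`. -/
def pureTensor (W : FBModule G k) (n : ℕ) {m : ℕ} (w : W.obj (FB.mk n))
    (φ : (FI.mk n : FI G) ⟶ FI.mk m) : (relProjPiece W n).obj (FI.mk m) :=
  (balancedRel W n (FI.mk m)).mkQ (w ⊗ₜ[k] Finsupp.single φ 1)

lemma act_pureTensor (W : FBModule G k) (n : ℕ) {m l : ℕ} (w : W.obj (FB.mk n))
    (φ : (FI.mk n : FI G) ⟶ FI.mk m) (ψ : (FI.mk m : FI G) ⟶ FI.mk l) :
    act (relProjPiece W n) ψ (pureTensor W n w φ) = pureTensor W n w (φ ≫ ψ) :=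
  congrArg (balancedRel W n (FI.mk l)).mkQ (postcomp_tmul_single W n ψ w φ)

lemma pureTensor_map (W : FBModule G k) (n : ℕ) {m : ℕ} (w : W.obj (FB.mk n))
    (σ : (FB.mk n : FB G) ⟶ FB.mk n) (φ : (FI.mk n : FI G) ⟶ FI.mk m) :
    pureTensor W n ((W.map σ).hom w) φ = pureTensor W n w (σ.1 ≫ φ) :=
  (Submodule.Quotient.eq _).2 (Submodule.subset_span ⟨σ, φ, w, rfl⟩)

lemma pureTensor_zero (W : FBModule G k) (n : ℕ) {m : ℕ} (φ : (FI.mk n : FI G) ⟶ FI.mk m) :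
    pureTensor W n 0 φ = 0 := by
  rw [pureTensor, TensorProduct.zero_tmul, map_zero]
  rfl

lemma piece_hom_ext {W : FBModule G k} {n m : ℕ} {N : Type*} [AddCommGroup N] [Module k N]
    {f g : (relProjPiece W n).obj (FI.mk m) →ₗ[k] N}
    (h : ∀ w φ, f (pureTensor W n w φ) = g (pureTensor W n w φ)) : f = g := by
  refine Submodule.linearMap_qext _ (TensorProduct.ext (LinearMap.ext fun w => ?_))
  exact Finsupp.lhom_ext' fun φ => LinearMap.ext_ring (h w φ)

lemma piece_induction {W : FBModule G k} {n m : ℕ}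
    (p : Submodule k ((relProjPiece W n).obj (FI.mk m))) (h : ∀ w φ, pureTensor W n w φ ∈ p)
    (x : (relProjPiece W n).obj (FI.mk m)) : x ∈ p := by
  rw [← Submodule.Quotient.mk_eq_zero p]
  have : p.mkQ = 0 := piece_hom_ext fun w φ => (Submodule.Quotient.mk_eq_zero p).2 (h w φ)
  exact LinearMap.congr_fun this x

/-- The linear map `W_n ⊗ k[Hom([n], [m])] → V_m` sending `w ⊗ φ` to `V(φ)(f(w))`. -/
def tensorDesc {W : FBModule G k} {V : FIModule G k} {n : ℕ}
    (f : W.obj (FB.mk n) →ₗ[k] V.obj (FI.mk n)) (m : ℕ) :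
    W.obj (FB.mk n) ⊗[k] (((FI.mk n : FI G) ⟶ FI.mk m) →₀ k) →ₗ[k] V.obj (FI.mk m) :=
  TensorProduct.lift ((Finsupp.llift (V.obj (FI.mk m)) k k _).toLinearMap ∘ₗ
    LinearMap.pi fun φ => act V φ ∘ₗ f)

lemma tensorDesc_tmul_single {W : FBModule G k} {V : FIModule G k} {n : ℕ}
    (f : W.obj (FB.mk n) →ₗ[k] V.obj (FI.mk n)) {m : ℕ} (w : W.obj (FB.mk n))
    (φ : (FI.mk n : FI G) ⟶ FI.mk m) :
    tensorDesc f m (w ⊗ₜ[k] Finsupp.single φ 1) = act V φ (f w) := by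
  simp [tensorDesc, Finsupp.llift_apply]

/-- Morphisms `M(W_n) ⟶ V` from `G_n`-equivariant maps `W_n → V_n`. -/
def pieceDesc {W : FBModule G k} {V : FIModule G k} {n : ℕ}
    (f : W.obj (FB.mk n) →ₗ[k] V.obj (FI.mk n))
    (hf : ∀ (σ : (FB.mk n : FB G) ⟶ FB.mk n) w, f ((W.map σ).hom w) = act V σ.1 (f w)) :
    relProjPiece W n ⟶ V :=
  have h : ∀ m, balancedRel W n (FI.mk m) ≤ LinearMap.ker (tensorDesc f m) := fun m => by
    refine Submodule.span_le.2 ?_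
    rintro _ ⟨σ, φ, w, rfl⟩
    rw [SetLike.mem_coe, LinearMap.mem_ker, map_sub, tensorDesc_tmul_single,
      tensorDesc_tmul_single, hf, act_act, sub_self]
  homMk (V := relProjPiece W n) (fun m => Submodule.liftQ _ (tensorDesc f m) (h m))
    fun {m l} φ x => by
      have : Submodule.liftQ _ (tensorDesc f l) (h l) ∘ₗ act (relProjPiece W n) φ =
          act V φ ∘ₗ Submodule.liftQ _ (tensorDesc f m) (h m) := by
        refine piece_hom_ext fun w ψ => ?_
        change Submodule.liftQ _ (tensorDesc f l) (h l)
            (act (relProjPiece W n) φ (pureTensor W n w ψ)) =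
          act V φ (tensorDesc f m (w ⊗ₜ[k] Finsupp.single ψ 1))
        rw [act_pureTensor, tensorDesc_tmul_single, act_act]
        exact tensorDesc_tmul_single f w (ψ ≫ φ)
      exact LinearMap.congr_fun this x

lemma comp_pieceDesc_pureTensor {W : FBModule G k} {V : FIModule G k} {n : ℕ}
    (f : W.obj (FB.mk n) →ₗ[k] V.obj (FI.mk n))
    (hf : ∀ (σ : (FB.mk n : FB G) ⟶ FB.mk n) w, f ((W.map σ).hom w) = act V σ.1 (f w)) {m : ℕ}
    (w : W.obj (FB.mk n)) (φ : (FI.mk n : FI G) ⟶ FI.mk m) :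
    comp (pieceDesc f hf) m (pureTensor W n w φ) = act V φ (f w) :=
  tensorDesc_tmul_single f w φ

/-- The natural retraction for `M(W_n)` sends `w ⊗ φ` to itself if `φ` misses `0`, and to zero
otherwise. -/
lemma splitsShift_relProjPiece (W : FBModule G k) (n : ℕ) : SplitsShift (relProjPiece W n) := by
  let r : ∀ m, (shifted (relProjPiece W n)).obj (FI.mk m) →ₗ[k] (relProjPiece W n).obj (FI.mk m) :=
    fun m => Submodule.mapQ (balancedRel W n (FI.mk (m + 1))) (balancedRel W n (FI.mk m))
      (LinearMap.lTensor _ (cut G k n m)) (by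
        refine Submodule.span_le.2 ?_
        rintro _ ⟨σ, φ, w, rfl⟩
        change LinearMap.lTensor _ _ _ ∈ balancedRel W n (FI.mk m)
        rw [map_sub, LinearMap.lTensor_tmul, LinearMap.lTensor_tmul]
        by_cases h : ∀ i, φ.f i ≠ 0
        · obtain ⟨ψ, rfl⟩ := (exists_eq_comp_std_iff φ).2 h
          rw [← Category.assoc, cut_comp_std, cut_comp_std]
          exact Submodule.subset_span ⟨σ, ψ, w, rfl⟩
        · push Not at h
          obtain ⟨i, hi⟩ := h
          obtain ⟨j, hj⟩ := σ.2.2 i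
          rw [cut_of_eq_zero φ hi, cut_of_eq_zero (σ.1 ≫ φ) (i := j) (by rw [← hi, ← hj]; rfl),
            TensorProduct.tmul_zero, TensorProduct.tmul_zero, sub_zero]
          exact zero_mem _)
  have hr : ∀ m (w : W.obj (FB.mk n)) (φ : (FI.mk n : FI G) ⟶ FI.mk m),
      r m (pureTensor W n w (φ ≫ std G m)) = pureTensor W n w φ := fun m w φ => by
    change (balancedRel W n (FI.mk m)).mkQ (w ⊗ₜ[k] (cut G k n m (Finsupp.single _ 1))) = _
    rw [cut_comp_std]
    rfl
  have hr0 : ∀ m (w : W.obj (FB.mk n)) (φ : (FI.mk n : FI G) ⟶ FI.mk (m + 1)) (i : Fin n),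
      φ.f i = 0 → r m (pureTensor W n w φ) = 0 := fun m w φ i hi => by
    change (balancedRel W n (FI.mk m)).mkQ (w ⊗ₜ[k] (cut G k n m (Finsupp.single _ 1))) = _
    rw [cut_of_eq_zero φ hi, TensorProduct.tmul_zero, map_zero]
    rfl
  refine ⟨homMk (V := shifted (relProjPiece W n)) r fun {m l} φ x => ?_, hom_ext' fun m x => ?_⟩
  · have : r l ∘ₗ act (relProjPiece W n) (shiftMap φ) = act (relProjPiece W n) φ ∘ₗ r m := by
      refine piece_hom_ext fun w ψ => ?_
      change r l (act (relProjPiece W n) (shiftMap φ) (pureTensor W n w ψ)) =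
        act (relProjPiece W n) φ (r m (pureTensor W n w ψ))
      rw [act_pureTensor]
      by_cases h : ∀ i, ψ.f i ≠ 0
      · obtain ⟨χ, rfl⟩ := (exists_eq_comp_std_iff ψ).2 h
        rw [hr, act_pureTensor, Category.assoc, std_shiftMap, ← Category.assoc, hr]
      · push Not at h
        obtain ⟨i, hi⟩ := h
        rw [hr0 m w ψ i hi, map_zero]
        refine hr0 l w _ i ?_
        change (shiftMap φ).f (ψ.f i) = 0
        rw [hi]
        rfl
    exact LinearMap.congr_fun this x
  · have : r m ∘ₗ act (relProjPiece W n) (std G m) = LinearMap.id := by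
      refine piece_hom_ext fun w ψ => ?_
      change r m (act (relProjPiece W n) (std G m) (pureTensor W n w ψ)) = pureTensor W n w ψ
      rw [act_pureTensor, hr]
    exact LinearMap.congr_fun this x

lemma IsRelProjective.splitsShift {V : FIModule G k} (h : IsRelProjective V) : SplitsShift V := by
  obtain ⟨W, ⟨e⟩⟩ := h
  exact (SplitsShift.sigma _ (splitsShift_relProjPiece W)).of_retract e.hom e.inv e.hom_inv_id

lemma IsRelProjective.derivTorsionFree {V : FIModule G k} (h : IsRelProjective V) :
    DerivTorsionFree V := h.splitsShift.derivTorsionFree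

/-- The restriction of an `FI_G`-module to `FB_G`. -/
def restrictFB (V : FIModule G k) : FBModule G k where
  obj X := V.obj (FI.mk X.card)
  map σ := V.map σ.1
  map_id X := V.map_id (FI.mk X.card)
  map_comp σ τ := V.map_comp σ.1 τ.1

/-- Every `FI_G`-module is a quotient of a relatively projective one. -/
lemma exists_relProj_epi (V : FIModule G k) : ∃ p : relProj (restrictFB V) ⟶ V, Epi p := by
  let q : ∀ n, relProjPiece (restrictFB V) n ⟶ V := fun n =>
    pieceDesc (W := restrictFB V) LinearMap.id fun _ _ => rfl
  let p : relProj (restrictFB V) ⟶ V := Sigma.desc q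
  refine ⟨p, ?_⟩
  have : ∀ Y, Epi (p.app Y) := by
    rintro ⟨n⟩
    refine (ModuleCat.epi_iff_surjective _).2 fun x => ?_
    refine ⟨comp (Sigma.ι (fun n => relProjPiece (restrictFB V) n) n) n
      (pureTensor (restrictFB V) n x (𝟙 (FI.mk n : FI G))), ?_⟩
    have h : Sigma.ι (fun n => relProjPiece (restrictFB V) n) n ≫ Sigma.desc q = q n :=
      Sigma.ι_desc q n
    have h' := congrArg (fun χ => comp χ n (pureTensor (restrictFB V) n x (𝟙 (FI.mk n : FI G)))) h
    refine h'.trans ((comp_pieceDesc_pureTensor _ _ _ _).trans (act_id V x))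
  exact NatTrans.epi_of_epi_app p

lemma derivTorsionFree_of_projective (P : FIModule G k) [Projective P] : DerivTorsionFree P := by
  obtain ⟨p, hp⟩ := exists_relProj_epi P
  have h : IsRelProjective (relProj (restrictFB P)) := ⟨_, ⟨Iso.refl _⟩⟩
  exact (h.splitsShift.of_retract (Projective.factorThru (𝟙 P) p) p
    (Projective.factorThru_comp _ _)).derivTorsionFree

/-! ### Exactness in the functor categories -/

lemma exact_iff_forall_evaluation {C : Type} [Category.{u} C]
    (S : ShortComplex (C ⥤ ModuleCat.{u} k)) :
    S.Exact ↔ ∀ X : C, (S.map ((evaluation C (ModuleCat.{u} k)).obj X)).Exact := by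
  constructor
  · intro h X
    exact h.map _
  · intro h
    rw [ShortComplex.exact_iff_isZero_homology, Functor.isZero_iff]
    intro X
    have := (h X)
    rw [ShortComplex.exact_iff_isZero_homology] at this
    exact this.of_iso (S.mapHomologyIso ((evaluation C (ModuleCat.{u} k)).obj X)).symm

lemma comp_surjective {V U : FIModule G k} (α : V ⟶ U) [Epi α] (n : ℕ) :
    Function.Surjective (comp α n) :=
  (ModuleCat.epi_iff_surjective (α.app (FI.mk n))).1 inferInstance

lemma comp_injective {V U : FIModule G k} (α : V ⟶ U) [Mono α] (n : ℕ) :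
    Function.Injective (comp α n) :=
  (ModuleCat.mono_iff_injective (α.app (FI.mk n))).1 inferInstance

lemma comp_eq_zero_iff_of_exact {X Y Z : FIModule G k} {α : X ⟶ Y} {β : Y ⟶ Z} {w : α ≫ β = 0}
    (h : (ShortComplex.mk α β w).Exact) {n : ℕ} (y : Y.obj (FI.mk n)) :
    comp β n y = 0 ↔ ∃ x, comp α n x = y := by
  have h1 := (ShortComplex.moduleCat_exact_iff _).1
    ((exact_iff_forall_evaluation _).1 h (FI.mk n)) y
  refine ⟨h1, ?_⟩
  rintro ⟨x, rfl⟩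
  exact congrArg (fun χ => comp χ n x) w

lemma isExact_of_shortExact {X Y Z : FIModule G k} {α : X ⟶ Y} {β : Y ⟶ Z} {w : α ≫ β = 0}
    (h : (ShortComplex.mk α β w).ShortExact) : IsExact α β := fun _ =>
  have := h.mono_f
  have := h.epi_g
  ⟨comp_surjective β, fun _ y => comp_eq_zero_iff_of_exact h.exact y,
    fun m _ => comp_injective α m⟩

/-! ### Homology and derivative-torsion-freeness -/

/-- The image under `H_0` of `X → Y → Z` is exact in degree `n` if every `y ∈ Y_n` mapped to
`Z_{<n}` is, modulo `Y_{<n}`, in the image of `X_n`. -/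
lemma exact_zerothHomology_iff {X Y Z : FIModule G k} {α : X ⟶ Y} {β : Y ⟶ Z}
    (w' : (zerothHomology G k).map α ≫ (zerothHomology G k).map β = 0) :
    (ShortComplex.mk _ _ w').Exact ↔ ∀ n (y : Y.obj (FI.mk n)), comp β n y ∈ lower Z n →
      ∃ l ∈ lower Y n, ∃ x, y = l + comp α n x := by
  rw [exact_iff_forall_evaluation]
  simp_rw [ShortComplex.moduleCat_exact_iff]
  constructor
  · intro h n y hy
    obtain ⟨x, hx⟩ := h (FB.mk n) (Submodule.Quotient.mk (p := lower Y n) y)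
      ((Submodule.Quotient.mk_eq_zero (lower Z n)).2 hy)
    obtain ⟨x, rfl⟩ := Submodule.Quotient.mk_surjective (lower X n) x
    have := (Submodule.Quotient.eq (lower Y n)).1 hx
    exact ⟨-(comp α n x - y), neg_mem this, x, by abel⟩
  · rintro h ⟨n⟩ y hy
    obtain ⟨y, rfl⟩ := Submodule.Quotient.mk_surjective (lower Y n) y
    obtain ⟨l, hl, x, rfl⟩ := h n y ((Submodule.Quotient.mk_eq_zero (lower Z n)).1 hy)
    refine ⟨Submodule.Quotient.mk (p := lower X n) x, ?_⟩
    refine (Submodule.Quotient.eq (lower Y n)).2 ?_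
    have : comp α n x - (l + comp α n x) = -l := by abel
    exact this ▸ neg_mem hl

/-- For an exact sequence `X → Y → Z → V → 0` with `Z` derivative-torsion-free, `H_0` of
`X → Y → Z` is exact if and only if `V` is derivative-torsion-free. -/
lemma exact_zerothHomology_iff_derivTorsionFree {X Y Z V : FIModule G k} {α : X ⟶ Y} {β : Y ⟶ Z}
    {γ : Z ⟶ V} (w : α ≫ β = 0) (hβ : (ShortComplex.mk α β w).Exact)
    (hγ : IsExact (rangeSub β).incl γ) (hZ : DerivTorsionFree Z)
    (w' : (zerothHomology G k).map α ≫ (zerothHomology G k).map β = 0) :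
    (ShortComplex.mk _ _ w').Exact ↔ DerivTorsionFree V := by
  rw [exact_zerothHomology_iff]
  constructor
  · intro h
    refine hγ.derivTorsionFree_of_mem_lower hZ ?_
    rintro n ⟨_, y, rfl⟩ hy
    obtain ⟨l, hl, x, rfl⟩ := h n y hy
    have h0 : comp (toRange β) n (comp α n x) = 0 :=
      (toRange_eq_zero_iff β).2 ((comp_eq_zero_iff_of_exact hβ _).2 ⟨x, rfl⟩)
    have := comp_mem_lower (toRange β) hl
    rw [← add_zero (comp (toRange β) n l), ← h0, ← map_add] at this
    exact this
  · intro hV n y hy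
    have h1 : comp (toRange β) n y ∈ lower (rangeSub β).module n := (hγ n).mem_lower (hV n) hy
    obtain ⟨l, hl, hly⟩ := exists_lower_of_surjective _ (toRange_surjective β) h1
    have h2 : comp β n (y - l) = 0 := by
      rw [← toRange_eq_zero_iff, map_sub, hly, sub_self]
    obtain ⟨x, hx⟩ := (comp_eq_zero_iff_of_exact hβ _).1 h2
    exact ⟨l, hl, x, by rw [hx]; abel⟩

/-- The syzygies of a resolution `X → V`: the module `V` itself, followed by the images of the
differentials. -/
def syzygy (X : ChainComplex (FIModule G k) ℕ) (V : FIModule G k) : ℕ → FIModule G k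
  | 0 => V
  | j + 1 => (rangeSub (X.d (j + 1) j)).module

/-- The map from the terms of a resolution with augmentation `γ` onto the syzygies. -/
def toSyzygy (X : ChainComplex (FIModule G k) ℕ) {V : FIModule G k} (γ : X.X 0 ⟶ V) :
    ∀ j, X.X j ⟶ syzygy X V j
  | 0 => γ
  | j + 1 => toRange (X.d (j + 1) j)

lemma isExact_toSyzygy {X : ChainComplex (FIModule G k) ℕ} {V : FIModule G k} {γ : X.X 0 ⟶ V}
    (hγ : IsExact (rangeSub (X.d 1 0)).incl γ) (hX : ∀ j, X.ExactAt (j + 1)) (j : ℕ) :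
    IsExact (rangeSub (X.d (j + 1) j)).incl (toSyzygy X γ j) := by
  cases j with
  | zero => exact hγ
  | succ j =>
    exact isExact_incl_of_range _ _ (toRange_surjective _) fun m y =>
      (toRange_eq_zero_iff _).trans (comp_eq_zero_iff_of_exact
        ((X.exactAt_iff' (j + 2) (j + 1) j (by simp) (by simp)).1 (hX j)) y)

lemma derivTorsionFree_syzygy_iff {X : ChainComplex (FIModule G k) ℕ} {V : FIModule G k}
    {γ : X.X 0 ⟶ V} (hγ : IsExact (rangeSub (X.d 1 0)).incl γ) (hX : ∀ j, X.ExactAt (j + 1))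
    (hT : ∀ j, DerivTorsionFree (X.X j)) (j : ℕ) :
    DerivTorsionFree (syzygy X V j) ↔ DerivTorsionFree V := by
  induction j with
  | zero => rfl
  | succ j ih =>
    exact ⟨fun h => ih.1 ((isExact_toSyzygy hγ hX j).derivTorsionFree_right h (hT j)),
      fun h => (isExact_toSyzygy hγ hX j).derivTorsionFree_left (hT j) (ih.2 h)⟩

/-- Each single homology group `H_{j + 1}(V)` detects whether `V` is derivative-torsion-free. -/
theorem isZero_homology_succ_iff (V : FIModule G k) (j : ℕ) :
    IsZero ((homology G k (j + 1)).obj V) ↔ DerivTorsionFree V := by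
  let P := projectiveResolution V
  let K := ((zerothHomology G k).mapHomologicalComplex (ComplexShape.down ℕ)).obj P.complex
  have h1 : IsZero ((homology G k (j + 1)).obj V) ↔ IsZero (K.homology (j + 1)) :=
    (P.isoLeftDerivedObj (zerothHomology G k) (j + 1)).isZero_iff
  have hγ : IsExact (rangeSub (P.complex.d 1 0)).incl (Z := V) (P.π.f 0) :=
    isExact_incl_of_range _ _ (comp_surjective (P.π.f 0)) fun m y =>
      comp_eq_zero_iff_of_exact P.exact₀ y
  have hT : ∀ i, DerivTorsionFree (P.complex.X i) := fun i => derivTorsionFree_of_projective _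
  rw [h1, ← HomologicalComplex.exactAt_iff_isZero_homology,
    K.exactAt_iff' (j + 2) (j + 1) j (by simp) (by simp),
    ← derivTorsionFree_syzygy_iff hγ P.complex_exactAt_succ hT j]
  exact exact_zerothHomology_iff_derivTorsionFree (P.complex.d_comp_d _ _ _) (P.exact_succ j)
    (isExact_toSyzygy hγ P.complex_exactAt_succ j) (hT j) (K.d_comp_d _ _ _)

/-! ### Invariance properties -/

lemma comp_hom_inv {V U : FIModule G k} (e : V ≅ U) {n : ℕ} (x : V.obj (FI.mk n)) :
    comp e.inv n (comp e.hom n x) = x :=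
  congrArg (fun χ => comp χ n x) e.hom_inv_id

lemma forall_eq_zero_of_isZero {V : FIModule G k} (h : IsZero V) {n : ℕ} (x : V.obj (FI.mk n)) :
    x = 0 :=
  congrArg (fun χ => comp χ n x) (h.eq_of_src (𝟙 V) 0)

lemma isZero_of_forall_eq_zero {V : FIModule G k} (h : ∀ n (x : V.obj (FI.mk n)), x = 0) :
    IsZero V :=
  (IsZero.iff_id_eq_zero V).2 (hom_ext' h)

lemma derivTorsionFree_of_isZero {V : FIModule G k} (h : IsZero V) : DerivTorsionFree V :=
  SplitsShift.derivTorsionFree ⟨0, h.eq_of_src _ _⟩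

lemma DerivTorsionFree.of_iso {V U : FIModule G k} (h : DerivTorsionFree V) (e : V ≅ U) :
    DerivTorsionFree U := by
  obtain ⟨Z, hZ⟩ := HasZeroObject.zero (C := FIModule G k)
  have hex : IsExact (0 : Z ⟶ V) e.hom := fun _ => by
    refine ⟨fun m => comp_surjective e.hom m, fun m y => ⟨fun hy => ⟨0, ?_⟩, ?_⟩,
      fun m _ => (injective_iff_map_eq_zero _).2 fun x _ => forall_eq_zero_of_isZero hZ x⟩
    · rw [← comp_hom_inv e y, hy, map_zero, map_zero]
    · rintro ⟨x, rfl⟩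
      exact map_zero _
  exact hex.derivTorsionFree_right (derivTorsionFree_of_isZero hZ) h

/-- An injective and surjective morphism is an isomorphism. -/
lemma isIso_of_bijective {V U : FIModule G k} (α : V ⟶ U)
    (h : ∀ n, Function.Bijective (comp α n)) : IsIso α := by
  have : ∀ Y, IsIso (α.app Y) := fun Y =>
    (ConcreteCategory.isIso_iff_bijective (α.app Y)).2 (h Y.card)
  exact NatIso.isIso_of_isIso_app α

/-! ### The submodule generated in small degrees -/

/-- The submodule of `V` generated by the elements of degree `< j`. -/
def below (V : FIModule G k) (j : ℕ) : Sub V where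
  deg n := ⨆ (m : ℕ) (_ : m < j) (φ : (FI.mk m : FI G) ⟶ FI.mk n), LinearMap.range (act V φ)
  act_mem {n l} ψ x hx := by
    have : (⨆ (m : ℕ) (_ : m < j) (φ : (FI.mk m : FI G) ⟶ FI.mk n), LinearMap.range (act V φ)) ≤
        (⨆ (m : ℕ) (_ : m < j) (φ : (FI.mk m : FI G) ⟶ FI.mk l),
          LinearMap.range (act V φ)).comap (act V ψ) := by
      refine iSup_le fun m => iSup_le fun hm => iSup_le fun φ => ?_
      rintro _ ⟨y, rfl⟩
      rw [Submodule.mem_comap, act_act]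
      exact Submodule.mem_iSup_of_mem m (Submodule.mem_iSup_of_mem hm
        (Submodule.mem_iSup_of_mem (φ ≫ ψ) ⟨y, rfl⟩))
    exact this hx

lemma act_mem_below (V : FIModule G k) {j m n : ℕ} (hm : m < j)
    (φ : (FI.mk m : FI G) ⟶ FI.mk n) (x : V.obj (FI.mk m)) : act V φ x ∈ (below V j).deg n :=
  (le_iSup_of_le m (le_iSup_of_le hm (le_iSup_of_le φ le_rfl)) :
    LinearMap.range (act V φ) ≤ (below V j).deg n) ⟨x, rfl⟩

lemma below_le (V : FIModule G k) {j n : ℕ} {p : Submodule k (V.obj (FI.mk n))}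
    (h : ∀ m < j, ∀ (φ : (FI.mk m : FI G) ⟶ FI.mk n) (x : V.obj (FI.mk m)), act V φ x ∈ p) :
    (below V j).deg n ≤ p := by
  refine iSup_le fun m => iSup_le fun hm => iSup_le fun φ => ?_
  rintro _ ⟨x, rfl⟩
  exact h m hm φ x

lemma mem_below_of_lt (V : FIModule G k) {j n : ℕ} (h : n < j) (x : V.obj (FI.mk n)) :
    x ∈ (below V j).deg n := by
  have := act_mem_below V h (𝟙 (FI.mk n : FI G)) x
  rwa [act_id] at this

lemma below_mono (V : FIModule G k) {i j : ℕ} (h : i ≤ j) (n : ℕ) :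
    (below V i).deg n ≤ (below V j).deg n :=
  below_le V fun _ hm φ x => act_mem_below V (hm.trans_le h) φ x

lemma mem_lower_below (V : FIModule G k) {j n : ℕ} (h : j ≤ n)
    (x : (below V j).module.obj (FI.mk n)) : x ∈ lower (below V j).module n := by
  obtain ⟨x, hx⟩ := x
  have : (below V j).deg n ≤ (lower (below V j).module n).map (comp (below V j).incl n) := by
    refine below_le V fun m hm φ y => ?_
    exact ⟨act (below V j).module φ ⟨y, mem_below_of_lt V hm y⟩,
      act_mem_lower _ (hm.trans_le h) _ _, rfl⟩
  obtain ⟨y, hy, hyx⟩ := this hx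
  have : y = ⟨x, hx⟩ := Subtype.ext hyx
  exact this ▸ hy

/-- The inclusion of `below V j` into `V` induces an injection on `H_0`. -/
lemma mem_lower_below_of_mem_lower (V : FIModule G k) {j n : ℕ}
    (x : (below V j).module.obj (FI.mk n)) (hx : comp (below V j).incl n x ∈ lower V n) :
    x ∈ lower (below V j).module n := by
  rcases le_or_gt j n with h | h
  · exact mem_lower_below V h x
  · have : lower V n ≤ (lower (below V j).module n).map (comp (below V j).incl n) := by
      refine lower_le V n _ fun m hm φ y => ?_
      exact ⟨act (below V j).module φ ⟨y, mem_below_of_lt V (hm.trans h) y⟩,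
        act_mem_lower _ hm _ _, rfl⟩
    obtain ⟨y, hy, hyx⟩ := this hx
    exact (Sub.incl_injective _ n hyx) ▸ hy

lemma DerivTorsionFree.quot_below {V : FIModule G k} (h : DerivTorsionFree V) (j : ℕ) :
    DerivTorsionFree (below V j).quot :=
  (below V j).isExact_proj.derivTorsionFree_of_mem_lower h
    fun _ x => mem_lower_below_of_mem_lower V x

lemma DerivTorsionFree.module_below {V : FIModule G k} (h : DerivTorsionFree V) (j : ℕ) :
    DerivTorsionFree (below V j).module :=
  (below V j).isExact_proj.derivTorsionFree_left h (h.quot_below j)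

/-- A module generated in degree `≤ d` equals the submodule generated in degrees `< d + 1`. -/
lemma mem_below_of_generatedInDegreeLE {V : FIModule G k} {d : ℕ} (h : GeneratedInDegreeLE V d)
    {n : ℕ} (x : V.obj (FI.mk n)) : x ∈ (below V (d + 1)).deg n := by
  obtain ⟨I, e, p, he, hp⟩ := h
  have h0 : p ≫ (below V (d + 1)).proj = 0 := by
    refine Sigma.hom_ext _ _ fun i => free_hom_ext ?_
    exact (below V (d + 1)).proj_eq_zero_iff.2 (mem_below_of_lt V (Nat.lt_succ_of_le (he i)) _)
  have h1 : (below V (d + 1)).proj = 0 := (cancel_epi p).1 (h0.trans Limits.comp_zero.symm)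
  exact (below V (d + 1)).proj_eq_zero_iff.1 (congrArg (fun χ => comp χ n x) h1)

/-! ### Derivative-torsion-free modules concentrated in one generating degree -/

lemma isIso_sigma_ι {ι : Type*} [HasColimitsOfShape (Discrete ι) (ModuleCat.{u} k)]
    (V : ι → FIModule G k) (j : ι) (h : ∀ i, i ≠ j → IsZero (V i)) : IsIso (Sigma.ι V j) := by
  have : Epi (Sigma.ι V j) := ⟨fun f g hfg => Sigma.hom_ext _ _ fun i => by
    by_cases hi : i = j
    · subst hi; exact hfg
    · exact (h i hi).eq_of_src _ _⟩
  exact isIso_of_mono_of_epi _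

/-- If `R` vanishes below degree `j` and is generated in degree `j`, then `M(R_j) → R` is
surjective, with a kernel `K` vanishing in degrees `≤ j`. If `R` is moreover derivative-torsion-free
then `H_0(K)` embeds into `H_0(M(R_j))`, which lives in degree `j`, so that `K = 0`. -/
theorem isRelProjective_of_generated {R : FIModule G k} (hR : DerivTorsionFree R) (j : ℕ)
    (h0 : ∀ n < j, ∀ x : R.obj (FI.mk n), x = 0)
    (h1 : ∀ n (x : R.obj (FI.mk n)), j < n → x ∈ lower R n) : IsRelProjective R := by
  let W := zerothHomologyObj R
  have hj : lower R j = ⊥ := (Submodule.eq_bot_iff _).2 fun x hx => eq_zero_of_mem_lower h0 hx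
  let f : W.obj (FB.mk j) →ₗ[k] R.obj (FI.mk j) :=
    Submodule.liftQ (lower R j) LinearMap.id (by rw [hj]; exact bot_le)
  have hf0 : ∀ x : R.obj (FI.mk j), f (Submodule.Quotient.mk (p := lower R j) x) = x := fun _ => rfl
  have hf : ∀ (σ : (FB.mk j : FB G) ⟶ FB.mk j) w, f ((W.map σ).hom w) = act R σ.1 (f w) := by
    intro σ w
    obtain ⟨x, rfl⟩ := Submodule.Quotient.mk_surjective (lower R j) w
    rfl
  have hfinj : ∀ w, f w = 0 → w = 0 := by
    intro w hw
    obtain ⟨x, rfl⟩ := Submodule.Quotient.mk_surjective (lower R j) w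
    rw [hf0] at hw
    rw [hw]
    rfl
  let θ : relProjPiece W j ⟶ R := pieceDesc f hf
  have hθ : ∀ {m} w (φ : (FI.mk j : FI G) ⟶ FI.mk m),
      comp θ m (pureTensor W j w φ) = act R φ (f w) :=
    comp_pieceDesc_pureTensor f hf
  have hsurj : ∀ n, Function.Surjective (comp θ n) := by
    intro n
    induction n using Nat.strong_induction_on with
    | _ n ih =>
      intro x
      rcases lt_trichotomy n j with hn | rfl | hn
      · exact ⟨0, by rw [map_zero, h0 n hn x]⟩
      · exact ⟨pureTensor W n (Submodule.Quotient.mk (p := lower R n) x) (𝟙 _), 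
          (hθ (Submodule.Quotient.mk (p := lower R n) x) (𝟙 _)).trans (act_id R _)⟩
      · have : lower R n ≤ LinearMap.range (comp θ n) := by
          refine lower_le R n _ fun m hm φ y => ?_
          obtain ⟨z, rfl⟩ := ih m hm y
          exact ⟨act _ φ z, comp_act θ φ z⟩
        exact this (h1 n x hn)
  have hbot : ∀ n ≤ j, ∀ x : (relProjPiece W j).obj (FI.mk n), comp θ n x = 0 → x = 0 := by
    intro n hn x hx
    obtain rfl | hn := hn.eq_or_lt
    · -- an element of `M(R_n)_n` has the form `w ⊗ 𝟙`
      let s : W.obj (FB.mk n) →ₗ[k] (relProjPiece W n).obj (FI.mk n) :=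
        (balancedRel W n (FI.mk n)).mkQ ∘ₗ
          (TensorProduct.mk k _ _).flip (Finsupp.single (𝟙 (FI.mk n : FI G)) 1)
      have hs : ∀ w, s w = pureTensor W n w (𝟙 _) := fun _ => rfl
      obtain ⟨w, rfl⟩ : x ∈ LinearMap.range s := piece_induction _ (fun w φ => by
        let σ : (FB.mk n : FB G) ⟶ FB.mk n :=
          ⟨φ, Finite.injective_iff_bijective.1 φ.f.injective⟩
        refine ⟨(W.map σ).hom w, ?_⟩
        rw [hs, pureTensor_map, Category.comp_id]) x
      rw [hs, hθ, act_id] at hx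
      rw [hfinj w hx, map_zero]
    · refine (Submodule.mem_bot k).1 (piece_induction ⊥ (fun w φ => ?_) x)
      have := Fintype.card_le_of_embedding φ.f
      simp only [Fintype.card_fin] at this
      omega
  have hlow : ∀ n (x : (relProjPiece W j).obj (FI.mk n)), j < n →
      x ∈ lower (relProjPiece W j) n := fun n x hn => by
    refine piece_induction _ (fun w φ => ?_) x
    have := act_mem_lower (relProjPiece W j) hn φ (pureTensor W j w (𝟙 _))
    rwa [act_pureTensor, Category.id_comp] at this
  have hex := isExact_kerSub θ hsurj
  have hK : ∀ n (x : (kerSub θ).module.obj (FI.mk n)), x = 0 := by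
    intro n
    induction n using Nat.strong_induction_on with
    | _ n ih =>
      intro x
      rcases le_or_gt n j with hn | hn
      · exact Subtype.ext (hbot n hn x.1 x.2)
      · exact eq_zero_of_mem_lower ih ((hex n).mem_lower (hR n) (hlow n _ hn))
  have hbij : ∀ n, Function.Bijective (comp θ n) := fun n =>
    ⟨(injective_iff_map_eq_zero _).2 fun x hx => congrArg Subtype.val (hK n ⟨x, hx⟩), hsurj n⟩
  have := isIso_of_bijective θ hbij
  have hz : ∀ n, n ≠ j → IsZero (relProjPiece W n) := by
    intro n hn
    have hW : ∀ w : W.obj (FB.mk n), w = 0 := fun w => by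
      obtain ⟨x, rfl⟩ := Submodule.Quotient.mk_surjective (lower R n) w
      rcases lt_or_gt_of_ne hn with hn | hn
      · rw [h0 n hn x]; rfl
      · exact (Submodule.Quotient.mk_eq_zero _).2 (h1 n x hn)
    refine isZero_of_forall_eq_zero fun m x =>
      (Submodule.mem_bot k).1 (piece_induction ⊥ (fun w φ => ?_) x)
    rw [hW w, pureTensor_zero]
    exact zero_mem _
  have : IsIso (Sigma.ι (fun n => relProjPiece W n) j) :=
    isIso_sigma_ι (fun n => relProjPiece W n) j hz
  let e := asIso (Sigma.ι (fun n => relProjPiece W n) j)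
  exact ⟨W, ⟨(asIso θ).symm.trans e⟩⟩

/-! ### Filtrations and cofiltrations -/

instance mono_incl {V : FIModule G k} (A : Sub V) : Mono A.incl := by
  have : ∀ Y, Mono (A.incl.app Y) := fun Y =>
    (ModuleCat.mono_iff_injective _).2 (A.incl_injective Y.card)
  exact NatTrans.mono_of_mono_app _

lemma mem_below_zero {V : FIModule G k} {n : ℕ} {x : V.obj (FI.mk n)}
    (hx : x ∈ (below V 0).deg n) : x = 0 :=
  (Submodule.mem_bot k).1 (below_le V (fun _ hm => absurd hm (Nat.not_lt_zero _)) hx)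

/-- A cofactor `Y / X` is relatively projective if `X` and `Y` agree in degrees `< j` and `Y` is
generated in degrees `≤ j`. -/
lemma IsExact.isRelProjective {X Y Z : FIModule G k} {α : X ⟶ Y} {β : Y ⟶ Z} (h : IsExact α β)
    (hX : DerivTorsionFree X) (hY : DerivTorsionFree Y) (j : ℕ)
    (hα : ∀ n < j, Function.Surjective (comp α n))
    (hY' : ∀ n (y : Y.obj (FI.mk n)), j < n → y ∈ lower Y n) : IsRelProjective Z := by
  refine isRelProjective_of_generated (h.derivTorsionFree_right hX hY) j (fun n hn z => ?_)
    fun n z hn => ?_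
  · obtain ⟨y, rfl⟩ := (h 0).surj n z
    obtain ⟨x, rfl⟩ := hα n hn y
    exact (h 0).comp_comp_eq_zero x
  · obtain ⟨y, rfl⟩ := (h 0).surj n z
    exact comp_mem_lower β (hY' n y hn)

lemma DerivTorsionFree.isRelProjective_cokernel {V : FIModule G k} (h : DerivTorsionFree V) {j : ℕ}
    (hle : Subobject.mk (below V j).incl ≤ Subobject.mk (below V (j + 1)).incl) :
    IsRelProjective (cokernel (Subobject.ofLE _ _ hle)) := by
  let e : ∀ i, (Subobject.mk (below V i).incl : FIModule G k) ≅ (below V i).module :=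
    fun i => Subobject.underlyingIso (below V i).incl
  have hT : ∀ i, DerivTorsionFree (Subobject.mk (below V i).incl : FIModule G k) := fun i =>
    (h.module_below i).of_iso (e i).symm
  have hex : IsExact (Subobject.ofLE _ _ hle) (cokernel.π _) :=
    isExact_of_shortExact (ShortComplex.ShortExact.mk'
      (ShortComplex.exact_cokernel _) inferInstance inferInstance)
  refine hex.isRelProjective (hT _) (hT _) j (fun n hn y => ?_) fun n y hn => ?_
  · let x : (below V j).module.obj (FI.mk n) :=
      ⟨comp (Subobject.mk (below V (j + 1)).incl).arrow n y, mem_below_of_lt V hn _⟩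
    refine ⟨comp (e j).inv n x, ?_⟩
    refine comp_injective (Subobject.mk (below V (j + 1)).incl).arrow n ?_
    have hcomp : (e j).inv ≫ Subobject.ofLE _ _ hle ≫
        (Subobject.mk (below V (j + 1)).incl).arrow = (below V j).incl := by
      rw [Subobject.ofLE_arrow, Subobject.underlyingIso_arrow]
    exact congrArg (fun χ => comp χ n x) hcomp
  · rw [← comp_hom_inv (e (j + 1)) y]
    exact comp_mem_lower _ (mem_lower_below V hn _)

lemma mk_below_le (V : FIModule G k) (i : ℕ) :
    Subobject.mk (below V i).incl ≤ Subobject.mk (below V (i + 1)).incl :=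
  Subobject.mk_le_mk_of_comm ((below V (i + 1)).lift (below V i).incl
    fun n x => below_mono V i.le_succ n x.2) (Sub.lift_incl _ _ _)

lemma mk_below_zero (V : FIModule G k) : Subobject.mk (below V 0).incl = ⊥ :=
  Subobject.mk_eq_bot_iff_zero.2 (hom_ext' fun _ x => mem_below_zero x.2)

lemma mk_below_eq_top {V : FIModule G k} {d : ℕ} (hd : GeneratedInDegreeLE V d) :
    Subobject.mk (below V (d + 1)).incl = ⊤ :=
  (Subobject.isIso_iff_mk_eq_top _).1 (isIso_of_bijective _ fun n =>
    ⟨Sub.incl_injective _ n, fun x => ⟨⟨x, mem_below_of_generatedInDegreeLE hd x⟩, rfl⟩⟩)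

/-- The filtration of `V` by the submodules generated in degrees `< i`. -/
theorem DerivTorsionFree.isSharpFiltered {V : FIModule G k} (h : DerivTorsionFree V)
    (hV : GeneratedInFiniteDegree V) : IsSharpFiltered V := by
  obtain ⟨d, hd⟩ := hV
  exact ⟨d + 1, fun i => Subobject.mk (below V i.val).incl, fun i => mk_below_le V i.val,
    mk_below_zero V, mk_below_eq_top hd,
    fun i => h.isRelProjective_cokernel (mk_below_le V i.val)⟩

lemma DerivTorsionFree.isRelProjective_kernel {V : FIModule G k} (h : DerivTorsionFree V)
    {j j' : ℕ} (hj : j' = j + 1) (α : (below V j).quot ⟶ (below V j').quot)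
    (hα : (below V j).proj ≫ α = (below V j').proj) :
    Epi α ∧ IsRelProjective (kernel α) := by
  subst hj
  have hα' : ∀ n x, comp α n (comp (below V j).proj n x) =
      comp (below V (j + 1)).proj n x := fun n x => congrArg (fun χ => comp χ n x) hα
  have hepi : Epi α := by
    have : ∀ Y, Epi (α.app Y) := fun Y => (ModuleCat.epi_iff_surjective _).2 fun z => by
      obtain ⟨x, rfl⟩ := (below V (j + 1)).proj_surjective Y.card z
      exact ⟨_, hα' Y.card x⟩
    exact NatTrans.epi_of_epi_app α
  have hex : IsExact (kernel.ι α) α := isExact_of_shortExact (ShortComplex.ShortExact.mk'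
    (ShortComplex.exact_kernel α) inferInstance inferInstance)
  refine ⟨hepi, isRelProjective_of_generated
    (hex.derivTorsionFree_left (h.quot_below _) (h.quot_below _)) j (fun n hn x => ?_)
    fun n x hn => ?_⟩
  · refine (hex n).eq_zero le_rfl ?_
    obtain ⟨y, hy⟩ := (below V j).proj_surjective n (comp (kernel.ι α) n x)
    rw [← hy]
    exact (below V j).proj_eq_zero_iff.2 (mem_below_of_lt V hn y)
  · have hle : (below V (j + 1)).deg n ≤
        ((lower (kernel α) n).map (comp (kernel.ι α) n)).comap (comp (below V j).proj n) := by
      refine below_le V fun m hm φ y => ?_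
      obtain ⟨z, hz⟩ := ((hex 0).exact m (comp (below V j).proj m y)).1 (by
        rw [hα']
        exact (below V (j + 1)).proj_eq_zero_iff.2 (mem_below_of_lt V hm y))
      refine ⟨act _ φ z, act_mem_lower _ (by omega) φ z, ?_⟩
      rw [comp_act, comp_act, hz]
    obtain ⟨y, hy⟩ := (below V j).proj_surjective n (comp (kernel.ι α) n x)
    have hy' : y ∈ (below V (j + 1)).deg n := by
      rw [← (below V (j + 1)).proj_eq_zero_iff, ← hα', hy, (hex 0).comp_comp_eq_zero]
    obtain ⟨z, hz, hzy⟩ := hle hy'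
    exact ((hex n).inj n le_rfl (hzy.trans hy)) ▸ hz

/-- The cofiltration of `V` by the quotients by the submodules generated in small degrees. -/
theorem DerivTorsionFree.hasRelProjCofiltration {V : FIModule G k} (h : DerivTorsionFree V)
    (hV : GeneratedInFiniteDegree V) : HasRelProjCofiltration V := by
  obtain ⟨d, hd⟩ := hV
  let Q : ℕ → FIModule G k := fun i => (below V (d + 1 - i)).quot
  let p : ∀ i, Q (i + 1) ⟶ Q i := fun i =>
    (below V (d + 1 - (i + 1))).desc (below V (d + 1 - i)).proj
      fun n x hx => (below V (d + 1 - i)).proj_eq_zero_iff.2 (below_mono V (by omega) n hx)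
  refine ⟨d + 1, fun i => Q i.val, fun i => p i.val, ?_, ?_, fun i => ?_⟩
  · change Nonempty ((below V (d + 1 - (d + 1))).quot ≅ V)
    rw [Nat.sub_self]
    have : IsIso (below V 0).proj := isIso_of_bijective _ fun n =>
      ⟨(injective_iff_map_eq_zero _).2 fun x hx =>
        mem_below_zero ((below V 0).proj_eq_zero_iff.1 hx), Sub.proj_surjective _ n⟩
    exact ⟨(asIso (below V 0).proj).symm⟩
  · refine isZero_of_forall_eq_zero fun n z => ?_
    obtain ⟨x, rfl⟩ := (below V (d + 1)).proj_surjective n z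
    exact (below V (d + 1)).proj_eq_zero_iff.2 (mem_below_of_generatedInDegreeLE hd x)
  · exact h.isRelProjective_kernel (by omega) (p i.val) (hom_ext' fun _ _ => rfl)

lemma IsSharpFiltered.derivTorsionFree {V : FIModule G k} (h : IsSharpFiltered V) :
    DerivTorsionFree V := by
  obtain ⟨n, F, hF, h0, hn, hc⟩ := h
  have key : ∀ i : Fin (n + 1), DerivTorsionFree (F i : FIModule G k) := by
    intro i
    induction i using Fin.induction with
    | zero =>
      rw [h0]
      exact derivTorsionFree_of_isZero (IsZero.of_iso (isZero_zero _) Subobject.botCoeIsoZero)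
    | succ i ih =>
      exact (isExact_of_shortExact (ShortComplex.ShortExact.mk'
        (ShortComplex.exact_cokernel _) inferInstance inferInstance)).derivTorsionFree_middle ih
          (hc i).derivTorsionFree
  have := key (Fin.last n)
  rw [hn] at this
  exact this.of_iso (asIso (⊤ : Subobject V).arrow)

lemma HasRelProjCofiltration.derivTorsionFree {V : FIModule G k} (h : HasRelProjCofiltration V) :
    DerivTorsionFree V := by
  obtain ⟨n, Q, p, ⟨e⟩, h0, hp⟩ := h
  have key : ∀ i : Fin (n + 1), DerivTorsionFree (Q i) := by
    intro i
    induction i using Fin.induction with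
    | zero => exact derivTorsionFree_of_isZero h0
    | succ i ih =>
      have := (hp i).1
      exact (isExact_of_shortExact (ShortComplex.ShortExact.mk'
        (ShortComplex.exact_kernel (p i)) inferInstance inferInstance)).derivTorsionFree_middle
          (hp i).2.derivTorsionFree ih
  exact (key (Fin.last n)).of_iso e

/-! ### Finite resolutions -/

lemma HasFiniteAcyclicResolution.derivTorsionFree {V : FIModule G k}
    (h : HasFiniteAcyclicResolution V) : DerivTorsionFree V := by
  obtain ⟨X, π, hπ, ⟨N, hN⟩, hX⟩ := h
  have hX' : ∀ i, DerivTorsionFree (X.X i) := fun i =>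
    (isZero_homology_succ_iff _ 0).1 ((hX i).1 1 le_rfl)
  have hexact : ∀ j, X.ExactAt (j + 1) := fun j => by
    rw [← quasiIsoAt_iff_exactAt' π (j + 1) (ChainComplex.exactAt_succ_single_obj _ _)]
    infer_instance
  have hγ : IsExact (rangeSub (X.d 1 0)).incl (X.pOpcycles 0) :=
    isExact_incl_of_range _ _ (comp_surjective _) fun m y =>
      comp_eq_zero_iff_of_exact (ShortComplex.exact_of_g_is_cokernel
        (ShortComplex.mk _ _ (X.d_pOpcycles 1 0)) (X.opcyclesIsCokernel 1 0 (by simp))) y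
  have h0 : DerivTorsionFree (syzygy X (X.opcycles 0) (N + 2)) :=
    derivTorsionFree_of_isZero (isZero_of_forall_eq_zero fun n x =>
      Subtype.ext (forall_eq_zero_of_isZero (hN (N + 1) N.lt_succ_self) x.1))
  exact ((derivTorsionFree_syzygy_iff hγ hexact hX' _).1 h0).of_iso
    (X.isoHomologyι₀.symm ≪≫ isoOfQuasiIsoAt π 0 ≪≫
      HomologicalComplex.singleObjHomologySelfIso _ _ _)

lemma IsHomologyAcyclic.hasFiniteAcyclicResolution {V : FIModule G k} (h : IsHomologyAcyclic V)
    (hV : GeneratedInFiniteDegree V) : HasFiniteAcyclicResolution V := by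
  have hz : ∀ i, 0 < i → IsZero (((ChainComplex.single₀ (FIModule G k)).obj V).X i) := fun i hi =>
    HomologicalComplex.isZero_single_obj_X _ _ _ _ hi.ne'
  refine ⟨(ChainComplex.single₀ (FIModule G k)).obj V, 𝟙 _, inferInstance, ⟨0, hz⟩, fun i => ?_⟩
  cases i with
  | zero => exact ⟨h, hV⟩
  | succ i =>
    refine ⟨fun j hj => ?_, 0, PEmpty, PEmpty.elim, 0, fun i => i.elim, ?_⟩
    · obtain ⟨j, rfl⟩ := Nat.exists_eq_succ_of_ne_zero (by omega : j ≠ 0)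
      exact (isZero_homology_succ_iff _ j).2 (derivTorsionFree_of_isZero (hz _ i.succ_pos))
    · exact ⟨fun f g _ => (hz _ i.succ_pos).eq_of_src _ _⟩

end

end FIG

theorem theoremB (G : Type u) [Group G] (k : Type u) [CommRing k] (V : FIG.FIModule G k)
    (hV : FIG.GeneratedInFiniteDegree V) :
    List.TFAE [
      FIG.IsSharpFiltered V,
      FIG.HasRelProjCofiltration V,
      FIG.IsHomologyAcyclic V,
      IsZero ((FIG.homology G k 1).obj V),
      FIG.HasFiniteAcyclicResolution V] ∧
    (FIG.PresentedInFiniteDegree V →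
      ((∃ i : ℕ, 0 < i ∧ IsZero ((FIG.homology G k i).obj V)) ↔ FIG.IsSharpFiltered V)) := by
  have h1 : FIG.IsSharpFiltered V ↔ FIG.DerivTorsionFree V :=
    ⟨fun h => h.derivTorsionFree, fun h => h.isSharpFiltered hV⟩
  have h2 : FIG.HasRelProjCofiltration V ↔ FIG.DerivTorsionFree V :=
    ⟨fun h => h.derivTorsionFree, fun h => h.hasRelProjCofiltration hV⟩
  have h3 : FIG.IsHomologyAcyclic V ↔ FIG.DerivTorsionFree V :=
    ⟨fun h => (FIG.isZero_homology_succ_iff V 0).1 (h 1 le_rfl), fun h i hi => by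
      obtain ⟨j, rfl⟩ := Nat.exists_eq_succ_of_ne_zero (Nat.one_le_iff_ne_zero.1 hi)
      exact (FIG.isZero_homology_succ_iff V j).2 h⟩
  have h4 := FIG.isZero_homology_succ_iff V 0
  have h5 : FIG.HasFiniteAcyclicResolution V ↔ FIG.DerivTorsionFree V :=
    ⟨fun h => h.derivTorsionFree, fun h => (h3.2 h).hasFiniteAcyclicResolution hV⟩
  refine ⟨?_, fun _ => ⟨?_, fun h => ⟨1, Nat.one_pos, h4.2 (h1.1 h)⟩⟩⟩
  · tfae_have 1 ↔ 4 := h1.trans h4.symm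
    tfae_have 2 ↔ 4 := h2.trans h4.symm
    tfae_have 3 ↔ 4 := h3.trans h4.symm
    tfae_have 5 ↔ 4 := h5.trans h4.symm
    tfae_finish
  · rintro ⟨i, hi, h⟩
    obtain ⟨j, rfl⟩ := Nat.exists_eq_succ_of_ne_zero hi.ne'
    exact h1.2 ((FIG.isZero_homology_succ_iff V j).1 h)
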